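/- Let $p\ge 2$ be even, let $m$ be a positive multiple of $p$ with $m\neq p$, and put $q=m/p$. Let $H=G(m,p,2)\subseteq GL_2(\mathbb C)$ be the group of matrices $PD$ with $P$ a permutation matrix and $D$ a diagonal matrix whose entries are $m$-th roots of unity and $\det(D)^{q}=1$. Let $H$ act on $S=\mathbb C[x,y]$ by linear substitutions, let $R=S^H$, and put $$\sigma_1=(xy)^q,\qquad \sigma_2=x^m+y^m,\qquad z=xy(x^m-y^m),\qquad \Delta=\sigma_1(\sigma_2^2-4\sigma_1^p).$$ Then $\sigma_1,\sigma_2$ are algebraically independent and $R=\mathbb C[\sigma_1,\sigma_2]$; and, for suitable linear forms $\alpha_W$ defining the finitely many reflecting hyperplanes $W$ of $H$, $z=\prod_W\alpha_W$ and $\Delta=\prod_W\alpha_W^{e_W}$, where $e_W$ is the order of the pointwise stabilizer of $W$ in $H$. In particular $z$ divides $\Delta$ in $S$, so $S/(z)$ is a module over $R/(\Delta)$. For a square matrix $\varphi$ of size $n$ over $R$ write $\mathrm{Coker}(\varphi)=R^n/\varphi R^n$, and let $$K_j=\mathrm{Coker}\begin{pmatrix}\sigma_2&2\sigma_1^{j}\\2\sigma_1^{p-j}&\sigma_2\end{pmatrix},\quad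 N_j=\mathrm{Coker}\begin{pmatrix}\sigma_2\sigma_1&-2\sigma_1^{j+1}\\-2\sigma_1^{p+1-j}&\sigma_2\sigma_1\end{pmatrix},\quad X_j=\mathrm{Coker}\begin{pmatrix}\sigma_2&2\sigma_1^{j}\\2\sigma_1^{p+1-j}&\sigma_2\sigma_1\end{pmatrix}\qquad(0\le j\le p),$$ $$C_\pm=\mathrm{Coker}\bigl(\sigma_1(\sigma_2\pm2\sigma_1^{p/2})\bigr),\qquad D_\pm=\mathrm{Coker}\bigl(\sigma_2\mp2\sigma_1^{p/2}\bigr).$$ Each of these matrices is one half of a matrix factorization of $\Delta$, so these cokernels are $R/(\Delta)$-modules. Then, as $R/(\Delta)$-modules, $$\begin{aligned}S/(z)\cong{}&\bigoplus_{j=1}^{p}X_j^{2(q-1)}\oplus\bigoplus_{j=1}^{(p-2)/2}N_j^{2}\oplus\bigoplus_{j=1}^{(p-2)/2}K_j^{2(q-1)^2}\oplus K_{p/2}^{2\binom{q-1}{2}}\oplus K_0^{2\binom{q-1}{2}}\oplus R/(\sigma_1)\oplus\bigl(R/(\sigma_2^2-4\sigma_1^p)\bigr)^{q-1}\\&\oplus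 C_+\oplus D_+^{\,q-1}\oplus C_-\oplus D_-^{\,q-1}\oplus R/(\Delta)\\ \cong{}&\bigoplus_{j=1}^{p}X_j^{2(q-1)}\oplus\bigoplus_{j=1}^{(p-2)/2}N_j^{2}\oplus\bigoplus_{j=1}^{(p-2)/2}K_j^{2(q-1)^2}\oplus R/(\sigma_1)\oplus\bigl(R/(\sigma_2^2-4\sigma_1^p)\bigr)^{q-1+2\binom{q-1}{2}}\\&\oplus C_+\oplus D_+^{\,q-1+2\binom{q-1}{2}}\oplus C_-\oplus D_-^{\,q-1+2\binom{q-1}{2}}\oplus R/(\Delta).\end{aligned}$$ -/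

import Mathlib

open MvPolynomial

noncomputable section

namespace ReflGroup

theorem perm_mul_diagonal_apply {n : ℕ} (w : Equiv.Perm (Fin n)) (d : Fin n → ℂ) (i j : Fin n) :
    (w.permMatrix ℂ * Matrix.diagonal d) i j = if w i = j then d j else 0 := by
  simp [Equiv.Perm.permMatrix, PEquiv.toMatrix_apply, Equiv.toPEquiv_apply, eq_comm]

/-- The complex reflection group `G(m,p,n)`: the matrices `P * D` with `P` a permutation matrix and
`D` a diagonal matrix whose entries are `m`-th roots of unity and which satisfies
`det(D)^(m/p) = 1`. -/
def Gmpn (m p n : ℕ) : Subgroup (Matrix.GeneralLinearGroup (Fin n) ℂ) where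
  carrier := {g | ∃ (w : Equiv.Perm (Fin n)) (d : Fin n → ℂˣ), (∀ i, d i ^ m = 1) ∧
    (∏ i, d i) ^ (m / p) = 1 ∧
    (g : Matrix (Fin n) (Fin n) ℂ) = w.permMatrix ℂ * Matrix.diagonal (fun i => (d i : ℂ))}
  one_mem' := ⟨1, fun _ => 1, by simp, by simp, by simp⟩
  mul_mem' := by
    rintro g h ⟨w, d, hd, hd', hg⟩ ⟨v, e, he, he', hh⟩
    refine ⟨v * w, fun i => d (v.symm i) * e i, fun i => ?_, ?_, ?_⟩
    · rw [mul_pow, hd, he, one_mul]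
    · rw [Finset.prod_mul_distrib, Equiv.prod_comp v.symm d, mul_pow, hd', he', one_mul]
    · rw [Units.val_mul, hg, hh]
      ext i j
      rw [Matrix.mul_apply, perm_mul_diagonal_apply]
      simp only [perm_mul_diagonal_apply, ite_mul, zero_mul, Finset.sum_ite_eq, Finset.mem_univ,
        if_true]
      by_cases hij : v (w i) = j
      · subst hij; simp
      · simp [hij]
  inv_mem' := by
    rintro g ⟨w, d, hd, hd', hg⟩
    refine ⟨w⁻¹, fun i => (d (w i))⁻¹, fun i => ?_, ?_, ?_⟩
    · rw [inv_pow, hd, inv_one]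
    · rw [Finset.prod_inv_distrib, Equiv.prod_comp w d, inv_pow, hd', inv_one]
    · rw [Matrix.coe_units_inv]
      refine Matrix.inv_eq_left_inv ?_
      rw [hg]
      ext i j
      rw [Matrix.mul_apply]
      simp only [perm_mul_diagonal_apply, ite_mul, zero_mul, Finset.sum_ite_eq, Finset.mem_univ,
        if_true]
      by_cases hij : i = j
      · subst hij; simp
      · simp [hij]

/-! ### Invariants and the reflection arrangement of a subgroup of `GL_n(ℂ)` -/

/-- The action of a matrix on polynomial functions on `ℂⁿ` by linear substitution:
`subst g f = f ∘ g`. -/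
def subst {n : ℕ} (g : Matrix.GeneralLinearGroup (Fin n) ℂ) :
    MvPolynomial (Fin n) ℂ →ₐ[ℂ] MvPolynomial (Fin n) ℂ :=
  aeval fun i => ∑ j, C ((g : Matrix (Fin n) (Fin n) ℂ) i j) * X j

/-- The invariant ring `S^G`. -/
def invariants {n : ℕ} (G : Subgroup (Matrix.GeneralLinearGroup (Fin n) ℂ)) :
    Subalgebra ℂ (MvPolynomial (Fin n) ℂ) where
  carrier := {f | ∀ g ∈ G, subst g f = f}
  mul_mem' := fun ha hb g hg => by rw [map_mul, ha g hg, hb g hg]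
  add_mem' := fun ha hb g hg => by rw [map_add, ha g hg, hb g hg]
  algebraMap_mem' := fun r g _ => (subst g).commutes r

/-- The subspace of `ℂⁿ` fixed by `g`. -/
def fixedSpace {n : ℕ} (g : Matrix.GeneralLinearGroup (Fin n) ℂ) : Submodule ℂ (Fin n → ℂ) :=
  LinearMap.ker ((g : Matrix (Fin n) (Fin n) ℂ).mulVecLin - LinearMap.id)

/-- The set `A(G)` of reflecting hyperplanes: the hyperplanes which are the fixed space of an
element of `G`. -/
def hyperplanes {n : ℕ} (G : Subgroup (Matrix.GeneralLinearGroup (Fin n) ℂ)) :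
    Set (Submodule ℂ (Fin n → ℂ)) :=
  {W | Module.finrank ℂ W + 1 = n ∧ ∃ g ∈ G, fixedSpace g = W}

/-- The order `e_W` of the pointwise stabilizer of `W` in `G`. -/
def fixerOrder {n : ℕ} (G : Subgroup (Matrix.GeneralLinearGroup (Fin n) ℂ))
    (W : Submodule ℂ (Fin n → ℂ)) : ℕ :=
  Nat.card {g : Matrix.GeneralLinearGroup (Fin n) ℂ // g ∈ G ∧ W ≤ fixedSpace g}

/-- `a` is a linear form with zero set `W`. -/
def IsDefiningForm {n : ℕ} (W : Submodule ℂ (Fin n → ℂ)) (a : MvPolynomial (Fin n) ℂ) : Prop :=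
  a.IsHomogeneous 1 ∧ ∀ v, v ∈ W ↔ eval v a = 0

/-! ### Matrix factorizations and their cokernels -/

/-- A matrix factorization of `f`, of size `n`. -/
structure MatFact {B : Type} [CommRing B] (f : B) (n : ℕ) where
  φ : Matrix (Fin n) (Fin n) B
  ψ : Matrix (Fin n) (Fin n) B
  mul_eq : φ * ψ = f • (1 : Matrix (Fin n) (Fin n) B)
  mul_eq' : ψ * φ = f • (1 : Matrix (Fin n) (Fin n) B)

namespace MatFact

variable {B : Type} [CommRing B] {f : B} {n : ℕ}

/-- `Coker(φ,ψ) = Coker(φ) = Bⁿ / φ Bⁿ`. -/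
def Coker (M : MatFact f n) : Type := (Fin n → B) ⧸ LinearMap.range M.φ.mulVecLin

instance (M : MatFact f n) : AddCommGroup M.Coker :=
  inferInstanceAs (AddCommGroup ((Fin n → B) ⧸ LinearMap.range M.φ.mulVecLin))

instance (M : MatFact f n) : Module B M.Coker :=
  inferInstanceAs (Module B ((Fin n → B) ⧸ LinearMap.range M.φ.mulVecLin))

theorem isTorsion (M : MatFact f n) : Module.IsTorsionBySet B M.Coker (Ideal.span {f}) := by
  rw [Module.isTorsionBySet_span_singleton_iff]
  intro x
  obtain ⟨v, rfl⟩ := Submodule.Quotient.mk_surjective _ x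
  change Submodule.Quotient.mk (f • v) = 0
  rw [Submodule.Quotient.mk_eq_zero]
  refine ⟨M.ψ.mulVec v, ?_⟩
  simp [Matrix.mulVec_mulVec, M.mul_eq, Matrix.smul_mulVec]

/-- The cokernel is a module over the hypersurface ring `B/(f)`. -/
instance (M : MatFact f n) : Module (B ⧸ Ideal.span {f}) M.Coker := M.isTorsion.module

theorem mk_smul (M : MatFact f n) (b : B) (x : M.Coker) :
    (Ideal.Quotient.mk (Ideal.span {f}) b) • x = b • x := rfl

/-- The `1 × 1` matrix factorization `(a, b)` of `f = a * b`. Its cokernel is `B/(a)`. -/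
def ofMul (a b : B) (h : a * b = f) : MatFact f 1 where
  φ := !![a]
  ψ := !![b]
  mul_eq := by ext i j; fin_cases i; fin_cases j; simp [Matrix.mul_apply, h]
  mul_eq' := by ext i j; fin_cases i; fin_cases j; simp [Matrix.mul_apply, mul_comm b a, h]

end MatFact

/-! ### The Cohen–Macaulay modules over the `D_{p+2}` curve `s (t² - 4 s^p) = 0` -/

section Modules

variable {B : Type} [CommRing B] (s t : B) {p : ℕ}

/-- The equation of the discriminant in terms of `s = σ₁` and `t = σ₂`. -/
def disc (p : ℕ) : B := s * (t ^ 2 - 4 * s ^ p)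

/-- The matrix factorization `(φ_j, ψ_j)`. -/
def phiPsi (j : ℕ) (hj : j ≤ p) : MatFact (disc s t p) 2 where
  φ := !![t, 2 * s ^ j; 2 * s ^ (p - j), t]
  ψ := !![t * s, -2 * s ^ (j + 1); -2 * s ^ (p + 1 - j), t * s]
  mul_eq := by
    obtain ⟨k, rfl⟩ := Nat.exists_eq_add_of_le hj
    rw [show j + k - j = k by omega, show j + k + 1 - j = k + 1 by omega]
    ext a b; fin_cases a <;> fin_cases b <;> simp [disc] <;> ring
  mul_eq' := by
    obtain ⟨k, rfl⟩ := Nat.exists_eq_add_of_le hj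
    rw [show j + k - j = k by omega, show j + k + 1 - j = k + 1 by omega]
    ext a b; fin_cases a <;> fin_cases b <;> simp [disc] <;> ring

/-- The matrix factorization `(ψ_j, φ_j)`. -/
def psiPhi (j : ℕ) (hj : j ≤ p) : MatFact (disc s t p) 2 where
  φ := (phiPsi s t j hj).ψ
  ψ := (phiPsi s t j hj).φ
  mul_eq := (phiPsi s t j hj).mul_eq'
  mul_eq' := (phiPsi s t j hj).mul_eq

/-- The matrix factorization `(ξ_j, η_j)`. -/
def xiEta (j : ℕ) (hj : j ≤ p) : MatFact (disc s t p) 2 where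
  φ := !![t, 2 * s ^ j; 2 * s ^ (p + 1 - j), t * s]
  ψ := !![t * s, -2 * s ^ j; -2 * s ^ (p + 1 - j), t]
  mul_eq := by
    obtain ⟨k, rfl⟩ := Nat.exists_eq_add_of_le hj
    rw [show j + k + 1 - j = k + 1 by omega]
    ext a b; fin_cases a <;> fin_cases b <;> simp [disc] <;> ring
  mul_eq' := by
    obtain ⟨k, rfl⟩ := Nat.exists_eq_add_of_le hj
    rw [show j + k + 1 - j = k + 1 by omega]
    ext a b; fin_cases a <;> fin_cases b <;> simp [disc] <;> ring

/-- `X_j = Coker(ξ_j, η_j)`. -/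
abbrev XMod (j : ℕ) (hj : j ≤ p) : Type := (xiEta s t j hj).Coker

/-- `K_j = Coker(φ_j, ψ_j)`. -/
abbrev KMod (j : ℕ) (hj : j ≤ p) : Type := (phiPsi s t j hj).Coker

/-- `N_j = Coker(ψ_j, φ_j)`. -/
abbrev NMod (j : ℕ) (hj : j ≤ p) : Type := (psiPhi s t j hj).Coker

/-- `A = Coker(σ₁, σ₂² - 4 σ₁^p) = R/(σ₁)`. -/
abbrev AMod (p : ℕ) : Type :=
  (MatFact.ofMul (f := disc s t p) s (t ^ 2 - 4 * s ^ p) rfl).Coker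

/-- `B = Coker(σ₂² - 4 σ₁^p, σ₁) = R/(σ₂² - 4 σ₁^p)`. -/
abbrev BMod (p : ℕ) : Type :=
  (MatFact.ofMul (f := disc s t p) (t ^ 2 - 4 * s ^ p) s (mul_comm _ _)).Coker

theorem disc_plus (hp : Even p) :
    (s * (t + 2 * s ^ (p / 2))) * (t - 2 * s ^ (p / 2)) = disc s t p := by
  obtain ⟨k, rfl⟩ := hp
  rw [show (k + k) / 2 = k by omega, disc]; ring

theorem disc_minus (hp : Even p) :
    (s * (t - 2 * s ^ (p / 2))) * (t + 2 * s ^ (p / 2)) = disc s t p := by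
  rw [← disc_plus s t hp]; ring

/-- `C₊ = Coker(σ₁ (σ₂ + 2 σ₁^(p/2)), σ₂ - 2 σ₁^(p/2))`. -/
abbrev CPlus (hp : Even p) : Type :=
  (MatFact.ofMul (s * (t + 2 * s ^ (p / 2))) (t - 2 * s ^ (p / 2)) (disc_plus s t hp)).Coker

/-- `D₊ = Coker(σ₂ - 2 σ₁^(p/2), σ₁ (σ₂ + 2 σ₁^(p/2)))`. -/
abbrev DPlus (hp : Even p) : Type :=
  (MatFact.ofMul (t - 2 * s ^ (p / 2)) (s * (t + 2 * s ^ (p / 2)))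
    ((mul_comm _ _).trans (disc_plus s t hp))).Coker

/-- `C₋ = Coker(σ₁ (σ₂ - 2 σ₁^(p/2)), σ₂ + 2 σ₁^(p/2))`. -/
abbrev CMinus (hp : Even p) : Type :=
  (MatFact.ofMul (s * (t - 2 * s ^ (p / 2))) (t + 2 * s ^ (p / 2)) (disc_minus s t hp)).Coker

/-- `D₋ = Coker(σ₂ + 2 σ₁^(p/2), σ₁ (σ₂ - 2 σ₁^(p/2)))`. -/
abbrev DMinus (hp : Even p) : Type :=
  (MatFact.ofMul (t + 2 * s ^ (p / 2)) (s * (t - 2 * s ^ (p / 2)))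
    ((mul_comm _ _).trans (disc_minus s t hp))).Coker

theorem le_of_mem_Icc (j : Finset.Icc 1 p) : (j : ℕ) ≤ p := (Finset.mem_Icc.mp j.2).2

theorem le_of_mem_Icc_half (j : Finset.Icc 1 ((p - 2) / 2)) : (j : ℕ) ≤ p :=
  (Finset.mem_Icc.mp j.2).2.trans ((Nat.div_le_self _ _).trans (Nat.sub_le _ _))

end Modules

/-! ### The group `H = G(m,p,2)` -/

/-- The invariant ring `R = S^H`, where `S = ℂ[x,y]` and `H = G(m,p,2)`. -/
abbrev R (m p : ℕ) : Subalgebra ℂ (MvPolynomial (Fin 2) ℂ) := invariants (Gmpn m p 2)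

/-- An element of `G(m,p,2)` is diagonal or antidiagonal. -/
theorem subst_cases {m p : ℕ} {g : Matrix.GeneralLinearGroup (Fin 2) ℂ} (hg : g ∈ Gmpn m p 2) :
    ∃ a b : ℂ, a ^ m = 1 ∧ b ^ m = 1 ∧ (a * b) ^ (m / p) = 1 ∧
      ((subst g (X 0) = C a * X 0 ∧ subst g (X 1) = C b * X 1) ∨
        (subst g (X 0) = C a * X 1 ∧ subst g (X 1) = C b * X 0)) := by
  obtain ⟨w, d, hd, hd', hg⟩ := hg
  have hu : ∀ i, (d i : ℂ) ^ m = 1 := fun i => by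
    rw [← Units.val_pow_eq_pow_val, hd i, Units.val_one]
  have hu' : ((d 0 : ℂ) * d 1) ^ (m / p) = 1 := by
    rw [Fin.prod_univ_two] at hd'
    rw [← Units.val_mul, ← Units.val_pow_eq_pow_val, hd', Units.val_one]
  have h : ∀ i, subst g (X i) = C (d (w i) : ℂ) * X (w i) := fun i => by
    simp only [subst, aeval_X, hg, perm_mul_diagonal_apply, apply_ite C, C_0, ite_mul, zero_mul,
      Finset.sum_ite_eq, Finset.mem_univ, if_true]
  refine ⟨d (w 0), d (w 1), hu _, hu _, ?_, ?_⟩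
  · obtain hw | hw := (by decide : ∀ w : Equiv.Perm (Fin 2),
      (w 0 = 0 ∧ w 1 = 1) ∨ (w 0 = 1 ∧ w 1 = 0)) w
    · rw [hw.1, hw.2, hu']
    · rw [hw.1, hw.2, mul_comm, hu']
  · obtain hw | hw := (by decide : ∀ w : Equiv.Perm (Fin 2),
      (w 0 = 0 ∧ w 1 = 1) ∨ (w 0 = 1 ∧ w 1 = 0)) w
    · left; rw [h, h, hw.1, hw.2]; exact ⟨rfl, rfl⟩
    · right; rw [h, h, hw.1, hw.2]; exact ⟨rfl, rfl⟩

/-- `σ₁ = (xy)^q`, with `q = m/p`. -/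
def sigma1 (m p : ℕ) : R m p :=
  ⟨(X 0 * X 1) ^ (m / p), fun g hg => by
    obtain ⟨a, b, -, -, hab, ⟨h0, h1⟩ | ⟨h0, h1⟩⟩ := subst_cases hg
    · rw [map_pow, map_mul, h0, h1, show (C a * X 0 * (C b * X 1) : MvPolynomial (Fin 2) ℂ)
        = C (a * b) * (X 0 * X 1) by rw [C_mul]; ring, mul_pow, ← C_pow, hab, C_1, one_mul]
    · rw [map_pow, map_mul, h0, h1, show (C a * X 1 * (C b * X 0) : MvPolynomial (Fin 2) ℂ)
        = C (a * b) * (X 0 * X 1) by rw [C_mul]; ring, mul_pow, ← C_pow, hab, C_1, one_mul]⟩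

/-- `σ₂ = x^m + y^m`. -/
def sigma2 (m p : ℕ) : R m p :=
  ⟨X 0 ^ m + X 1 ^ m, fun g hg => by
    obtain ⟨a, b, ha, hb, -, ⟨h0, h1⟩ | ⟨h0, h1⟩⟩ := subst_cases hg
    · rw [map_add, map_pow, map_pow, h0, h1, mul_pow, mul_pow, ← C_pow, ← C_pow, ha, hb, C_1,
        one_mul, one_mul]
    · rw [map_add, map_pow, map_pow, h0, h1, mul_pow, mul_pow, ← C_pow, ← C_pow, ha, hb, C_1,
        one_mul, one_mul, add_comm]⟩

/-- The equation `z = xy(x^m - y^m)` of the reduced hyperplane arrangement of `G(m,p,2)`,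
for `m ≠ p`. -/
def z (m : ℕ) : MvPolynomial (Fin 2) ℂ := X 0 * X 1 * (X 0 ^ m - X 1 ^ m)

/-- The discriminant `Δ = σ₁(σ₂² - 4σ₁^p) ∈ R` of `G(m,p,2)`, for `m ≠ p`. -/
abbrev Delta (m p : ℕ) : R m p := disc (sigma1 m p) (sigma2 m p) p

/-- The coordinate ring `R/(Δ)` of the discriminant. -/
abbrev RDelta (m p : ℕ) : Type := R m p ⧸ Ideal.span {Delta m p}

theorem z_dvd_Delta {m p : ℕ} (hm : 0 < m) (hpm : p ∣ m) :
    z m ∣ (Delta m p : MvPolynomial (Fin 2) ℂ) := by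
  obtain ⟨q, rfl⟩ := hpm
  have hp : 0 < p := Nat.pos_of_mul_pos_right hm
  obtain ⟨k, rfl⟩ : ∃ k, q = k + 1 := Nat.exists_eq_succ_of_ne_zero (by rintro rfl; simp at hm)
  have h4 : ((4 : R (p * (k + 1)) p) : MvPolynomial (Fin 2) ℂ) = 4 := rfl
  refine ⟨(X 0 * X 1) ^ k * (X 0 ^ (p * (k + 1)) - X 1 ^ (p * (k + 1))), ?_⟩
  simp only [Delta, disc, sigma1, sigma2, z, Nat.mul_div_cancel_left _ hp, MulMemClass.coe_mul,
    AddSubgroupClass.coe_sub, SubmonoidClass.coe_pow, h4]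
  rw [← pow_mul, mul_comm (k + 1) p, mul_pow _ _ (p * (k + 1))]
  ring

/-- The coordinate ring `S/(z)` of the reduced hyperplane arrangement. -/
def SModZ {m p : ℕ} (_ : 0 < m) (_ : p ∣ m) : Type :=
  MvPolynomial (Fin 2) ℂ ⧸ Ideal.span {z m}

section

variable {m p : ℕ} (hm : 0 < m) (hpm : p ∣ m)

instance : CommRing (SModZ hm hpm) :=
  inferInstanceAs (CommRing (MvPolynomial (Fin 2) ℂ ⧸ Ideal.span {z m}))

instance : Module (R m p) (SModZ hm hpm) :=
  inferInstanceAs (Module (R m p) (MvPolynomial (Fin 2) ℂ ⧸ Ideal.span {z m}))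

theorem SModZ.isTorsion :
    Module.IsTorsionBySet (R m p) (SModZ hm hpm) (Ideal.span {Delta m p}) := by
  rw [Module.isTorsionBySet_span_singleton_iff]
  intro x
  obtain ⟨f, rfl⟩ := Ideal.Quotient.mk_surjective x
  change Ideal.Quotient.mk (Ideal.span {z m}) ((Delta m p : MvPolynomial (Fin 2) ℂ) * f) = 0
  rw [Ideal.Quotient.eq_zero_iff_mem, Ideal.mem_span_singleton]
  exact (z_dvd_Delta hm hpm).mul_right f

/-- `S/(z)` is a module over `R/(Δ)`, because `z` divides `Δ` in `S`. -/
instance : Module (RDelta m p) (SModZ hm hpm) := (SModZ.isTorsion hm hpm).module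

theorem SModZ.mk_smul_mk (r : R m p) (f : MvPolynomial (Fin 2) ℂ) :
    (Ideal.Quotient.mk (Ideal.span {Delta m p}) r) •
        (show SModZ hm hpm from Ideal.Quotient.mk (Ideal.span {z m}) f) =
      (show SModZ hm hpm from Ideal.Quotient.mk (Ideal.span {z m}) ((r : MvPolynomial (Fin 2) ℂ) * f)) :=
  rfl

end

end ReflGroup

end

/-! `S/(z)` is the cokernel of multiplication by `z` on `S`, an `R`-linear map of a free `R`-module.
The point is to find an `R`-basis of `S` in which this map falls apart into 2×2 blocks.

Write `m = p * q`. The diagonal matrices in `H` grade `S` by `p * q ^ 2` characters, recorded by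
`wt`. The elements of `R` have weight zero, and each isotypic component is free of rank 2 over `R`,
with a basis of two monomials x^(a+qk) y^b (`bf`) and x^a y^(b+q(p-k)) (`bg`), where a, b < q and k
takes p consecutive values. Spanning (`span_basis`) is a degree induction using σ₁ and σ₂.
Independence (`comb_injective`) separates the characters and then applies Cramer's rule to a
monomial pair and its image under the swap of x and y.

The factor xy of `z` moves (a, b) to (a+1, b+1) modulo q and costs a factor σ₁ whenever a coordinate
wraps around. The factor x^m - y^m preserves each component, with matrix (σ₂, 2σ₁^(p-k); -2σ₁^k,
-σ₂). Hence every block presents some K_j, X_j or N_j, according to whether zero, one or two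
coordinates wrap (`z_mul_comb`, `cokEquivBlocks`). With n = q - 1 there are n², 2n and 1 pairs (a,
b) of these kinds, each with p values of k. The symmetries K_j ≅ K_{p-j} and N_j ≅ N_{p-j} fold
these lists, and the fixed terms split: K_0 ≅ R/(σ₂² - 4σ₁^p), N_0 ≅ R/(σ₁) ⊕ R/(Δ), K_{p/2} ≅ D₊ ⊕
D₋, N_{p/2} ≅ C₊ ⊕ C₋. The two forms of the theorem differ in how many copies of K_0 and K_{p/2} are
rewritten.

For R = ℂ[σ₁, σ₂], an invariant is a combination of symmetrized monomials, each a power of σ₁ times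
a power sum of x^m and y^m; independence follows from surjectivity of (σ₁, σ₂) : ℂ² → ℂ². The
reflecting lines are found by computing the fixed spaces of diagonal and antidiagonal matrices. -/

noncomputable section

namespace ReflGroup

/-! ### Cokernels of square matrices -/

section Cok

variable {B : Type} [CommRing B]

/-- The cokernel of a square matrix. -/
abbrev Cok {n : ℕ} (M : Matrix (Fin n) (Fin n) B) : Type :=
  (Fin n → B) ⧸ LinearMap.range M.mulVecLin

/-- The linear map between cokernels induced by a commutative square of matrices. -/
def cokMap {n n' : ℕ} (M : Matrix (Fin n) (Fin n) B) (M' : Matrix (Fin n') (Fin n') B)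
    (P Q : Matrix (Fin n') (Fin n) B) (h : P * M = M' * Q) : Cok M →ₗ[B] Cok M' :=
  Submodule.mapQ _ _ P.mulVecLin (by
    rintro _ ⟨v, rfl⟩
    refine ⟨Q.mulVec v, ?_⟩
    simp [Matrix.mulVec_mulVec, h])

/-- The error term `M * E` has values in the range of `M`, so it dies in the cokernel. It is what
lets `M` and `M'` have different sizes, as in `cokKZero`. -/
theorem cokMap_comp_eq_id {n n' : ℕ} {M : Matrix (Fin n) (Fin n) B}
    {M' : Matrix (Fin n') (Fin n') B} {P Q : Matrix (Fin n') (Fin n) B}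
    {P' Q' : Matrix (Fin n) (Fin n') B} (h : P * M = M' * Q) (h' : P' * M' = M * Q')
    (E : Matrix (Fin n) (Fin n) B) (hE : P' * P = 1 + M * E) :
    (cokMap M' M P' Q' h').comp (cokMap M M' P Q h) = LinearMap.id := by
  refine LinearMap.ext fun x => ?_
  obtain ⟨v, rfl⟩ := Submodule.Quotient.mk_surjective _ x
  change Submodule.Quotient.mk (P'.mulVec (P.mulVec v)) = Submodule.Quotient.mk v
  rw [Submodule.Quotient.eq, Matrix.mulVec_mulVec, hE]
  refine ⟨E.mulVec v, ?_⟩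
  simp [Matrix.add_mulVec, Matrix.mulVec_mulVec]

/-- Matrices which are equivalent up to homotopy have isomorphic cokernels. -/
def cokEquiv {n n' : ℕ} (M : Matrix (Fin n) (Fin n) B) (M' : Matrix (Fin n') (Fin n') B)
    (P Q : Matrix (Fin n') (Fin n) B) (P' Q' : Matrix (Fin n) (Fin n') B)
    (E : Matrix (Fin n) (Fin n) B) (E' : Matrix (Fin n') (Fin n') B)
    (h : P * M = M' * Q) (h' : P' * M' = M * Q')
    (hE : P' * P = 1 + M * E) (hE' : P * P' = 1 + M' * E') : Cok M ≃ₗ[B] Cok M' :=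
  LinearEquiv.ofLinearMap (cokMap M M' P Q h) (cokMap M' M P' Q' h')
    (cokMap_comp_eq_id h' h E' hE') (cokMap_comp_eq_id h h' E hE)

/-- The cokernel of a diagonal `2 × 2` matrix. -/
def cokDiagEquiv (a b : B) : Cok !![a, 0; 0, b] ≃ₗ[B] Cok !![a] × Cok !![b] :=
  LinearEquiv.ofLinearMap
    ((cokMap _ _ !![1, 0] !![1, 0] (by ext i j; fin_cases i; fin_cases j <;> simp)).prod
      (cokMap _ _ !![0, 1] !![0, 1] (by ext i j; fin_cases i; fin_cases j <;> simp)))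
    ((cokMap _ _ !![1; 0] !![1; 0] (by ext i j; fin_cases j; fin_cases i <;> simp)).coprod
      (cokMap _ _ !![0; 1] !![0; 1] (by ext i j; fin_cases j; fin_cases i <;> simp)))
    (by
      refine LinearMap.ext fun ⟨x, y⟩ => ?_
      obtain ⟨v, rfl⟩ := Submodule.Quotient.mk_surjective _ x
      obtain ⟨w, rfl⟩ := Submodule.Quotient.mk_surjective _ y
      refine Prod.ext ?_ ?_
      · refine congrArg (Submodule.Quotient.mk (p := LinearMap.range (!![a]).mulVecLin))
          (?_ : (!![1, 0]).mulVec ((!![1; 0]).mulVec v + (!![0; 1]).mulVec w) = v)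
        ext i; fin_cases i; simp [Matrix.mulVec, dotProduct, Fin.sum_univ_two]
      · refine congrArg (Submodule.Quotient.mk (p := LinearMap.range (!![b]).mulVecLin))
          (?_ : (!![0, 1]).mulVec ((!![1; 0]).mulVec v + (!![0; 1]).mulVec w) = w)
        ext i; fin_cases i; simp [Matrix.mulVec, dotProduct, Fin.sum_univ_two])
    (by
      refine LinearMap.ext fun x => ?_
      obtain ⟨v, rfl⟩ := Submodule.Quotient.mk_surjective _ x
      refine congrArg (Submodule.Quotient.mk (p := LinearMap.range (!![a, 0; 0, b]).mulVecLin))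
          (?_ : (!![1; 0]).mulVec ((!![1, 0]).mulVec v) + (!![0; 1]).mulVec ((!![0, 1]).mulVec v)
            = v)
      ext i; fin_cases i <;> simp [dotProduct, Fin.sum_univ_two])

/-- The cokernel of a `1 × 1` matrix is a quotient by a principal ideal. -/
def cokSingletonEquiv (a : B) : (B ⧸ Ideal.span {a}) ≃ₗ[B] Cok !![a] :=
  Submodule.Quotient.equiv _ _ (LinearEquiv.funUnique (Fin 1) B B).symm (by
    ext v
    simp only [Submodule.mem_map, Ideal.mem_span_singleton', LinearMap.mem_range]
    constructor
    · rintro ⟨_, ⟨c, rfl⟩, rfl⟩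
      refine ⟨fun _ => c, ?_⟩
      ext i; fin_cases i
      simp [Matrix.mulVec, dotProduct, mul_comm]
    · rintro ⟨w, rfl⟩
      refine ⟨w 0 * a, ⟨w 0, rfl⟩, ?_⟩
      ext i; fin_cases i
      simp [Matrix.mulVec, dotProduct, mul_comm])

end Cok

/-! ### Isomorphisms between the modules `K_j`, `N_j`, `X_j` -/

section Blocks

variable {B : Type} [CommRing B] (s t : B) (p : ℕ)

/-- The matrix presenting `K_j`. -/
def matK (j : ℕ) : Matrix (Fin 2) (Fin 2) B := !![t, 2 * s ^ j; 2 * s ^ (p - j), t]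

/-- The matrix presenting `N_j`. -/
def matN (j : ℕ) : Matrix (Fin 2) (Fin 2) B :=
  !![t * s, -2 * s ^ (j + 1); -2 * s ^ (p + 1 - j), t * s]

/-- The matrix presenting `X_j`. -/
def matX (j : ℕ) : Matrix (Fin 2) (Fin 2) B :=
  !![t, 2 * s ^ j; 2 * s ^ (p + 1 - j), t * s]

variable {p}

/-- The swap of the two basis vectors gives `K_j ≅ K_{p-j}`. -/
def cokKSymm {j k : ℕ} (h : j + k = p) : Cok (matK s t p j) ≃ₗ[B] Cok (matK s t p k) :=
  cokEquiv _ _ !![0, 1; 1, 0] !![0, 1; 1, 0] !![0, 1; 1, 0] !![0, 1; 1, 0] 0 0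
    (by
      subst h; ext a b; fin_cases a <;> fin_cases b <;> simp [matK])
    (by
      subst h; ext a b; fin_cases a <;> fin_cases b <;> simp [matK])
    (by ext a b; fin_cases a <;> fin_cases b <;> simp)
    (by ext a b; fin_cases a <;> fin_cases b <;> simp)

/-- The swap of the two basis vectors gives `N_j ≅ N_{p-j}`. -/
def cokNSymm {j k : ℕ} (h : j + k = p) : Cok (matN s t p j) ≃ₗ[B] Cok (matN s t p k) :=
  cokEquiv _ _ !![0, 1; 1, 0] !![0, 1; 1, 0] !![0, 1; 1, 0] !![0, 1; 1, 0] 0 0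
    (by
      subst h
      have h1 : j + k + 1 - j = k + 1 := by omega
      have h2 : j + k + 1 - k = j + 1 := by omega
      ext a b; fin_cases a <;> fin_cases b <;> simp [matN, h1, h2])
    (by
      subst h
      have h1 : j + k + 1 - j = k + 1 := by omega
      have h2 : j + k + 1 - k = j + 1 := by omega
      ext a b; fin_cases a <;> fin_cases b <;> simp [matN, h1, h2])
    (by ext a b; fin_cases a <;> fin_cases b <;> simp)
    (by ext a b; fin_cases a <;> fin_cases b <;> simp)

/-- Equivalent matrices (`P M = M' Q` with `P`, `Q` invertible) have isomorphic cokernels. -/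
def cokEquivOfInv {n : ℕ} (M M' P Q P' Q' : Matrix (Fin n) (Fin n) B) (h : P * M = M' * Q)
    (hP : P' * P = 1) (hP' : P * P' = 1) (hQ : Q * Q' = 1) : Cok M ≃ₗ[B] Cok M' :=
  cokEquiv M M' P Q P' Q' 0 0 h
    (by
      calc P' * M' = P' * (M' * Q * Q') := by rw [mul_assoc M', hQ, mul_one]
        _ = (P' * P) * M * Q' := by rw [← h]; simp only [mul_assoc]
        _ = M * Q' := by rw [hP, one_mul])
    (by simp [hP]) (by simp [hP'])

variable {c : B} (hc : 2 * c = 1)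
include hc

/-- `K_0 ≅ R/(t² - 4 s^p)`. -/
def cokKZero : Cok (matK s t p 0) ≃ₗ[B] Cok !![t ^ 2 - 4 * s ^ p] :=
  -- The entry `2` is a unit with inverse `c`: the second column gives 2e₁ + te₂ = 0, so e₁ = -c t
  -- e₂ and only the determinant remains as a relation on e₂.
  cokEquiv _ _ !![-c * t, 1] !![-c, 0] !![0; 1] !![-2; t] !![0, 0; -c, 0] 0
    (by
      ext a b; fin_cases a; fin_cases b <;> simp [matK]
      · linear_combination (-2 * s ^ p) * hc
      · linear_combination (-t) * hc)
    (by
      ext a b; fin_cases b; fin_cases a <;> simp [matK] <;> ring)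
    (by
      ext a b; fin_cases a <;> fin_cases b <;> simp [matK]
      · linear_combination hc
      · ring)
    (by ext a b; fin_cases a; fin_cases b; simp)

/-- `N_0 ≅ R/(s) ⊕ R/(Δ)`. -/
def cokNZero : Cok (matN s t p 0) ≃ₗ[B] Cok !![s] × Cok !![disc s t p] :=
  -- Adding c t times the first row to the second makes the latter (c Δ, 0), while the first row is
  -- s (t, -2). The remaining factor `!![t, -2; c, 0]` has determinant 2c = 1.
  (cokEquivOfInv _ _ !![1, 0; c * t, 1] !![t, -2; c, 0] !![1, 0; -c * t, 1] !![0, 2; -c, t]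
    (by
      ext a b; fin_cases a <;> fin_cases b <;> simp [matN, disc]
      · ring
      · ring
      · linear_combination (2 * s ^ (p + 1)) * hc
      · linear_combination (- s * t) * hc)
    (by ext a b; fin_cases a <;> fin_cases b <;> simp)
    (by ext a b; fin_cases a <;> fin_cases b <;> simp)
    (by
      ext a b; fin_cases a <;> fin_cases b <;> simp
      · linear_combination hc
      · ring
      · linear_combination hc)).trans (cokDiagEquiv s (disc s t p))

/-- `K_h ≅ D₊ ⊕ D₋` for `p = 2h`. -/
def cokKHalf {h : ℕ} (hp : p = h + h) :
    Cok (matK s t p h) ≃ₗ[B] Cok !![t - 2 * s ^ h] × Cok !![t + 2 * s ^ h] :=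
  -- For p = 2h the two off-diagonal entries agree, so difference and sum of the coordinates
  -- diagonalize the matrix, with eigenvalues t - 2s^h and t + 2s^h.
  (cokEquivOfInv _ _ !![1, -1; 1, 1] !![1, -1; 1, 1] !![c, c; -c, c] !![c, c; -c, c]
    (by
      subst hp
      ext a b; fin_cases a <;> fin_cases b <;> simp [matK] <;> ring)
    (by
      ext a b; fin_cases a <;> fin_cases b <;> simp <;> linear_combination hc)
    (by
      ext a b; fin_cases a <;> fin_cases b <;> simp <;> linear_combination hc)
    (by
      ext a b; fin_cases a <;> fin_cases b <;> simp <;> linear_combination hc)).trans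
    (cokDiagEquiv _ _)

/-- `N_h ≅ C₊ ⊕ C₋` for `p = 2h`. -/
def cokNHalf {h : ℕ} (hp : p = h + h) :
    Cok (matN s t p h) ≃ₗ[B] Cok !![s * (t + 2 * s ^ h)] × Cok !![s * (t - 2 * s ^ h)] :=
  -- The same diagonalization; the off-diagonal entries are now negative, so the plus sign comes
  -- first.
  (cokEquivOfInv _ _ !![1, -1; 1, 1] !![1, -1; 1, 1] !![c, c; -c, c] !![c, c; -c, c]
    (by
      subst hp
      rw [matN, show h + h + 1 - h = h + 1 by omega]
      ext a b; fin_cases a <;> fin_cases b <;> simp <;> ring)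
    (by
      ext a b; fin_cases a <;> fin_cases b <;> simp <;> linear_combination hc)
    (by
      ext a b; fin_cases a <;> fin_cases b <;> simp <;> linear_combination hc)
    (by
      ext a b; fin_cases a <;> fin_cases b <;> simp <;> linear_combination hc)).trans
    (cokDiagEquiv _ _)

end Blocks

/-! ### Regrouping products of modules -/

section Regroup

variable (B : Type) [CommRing B]

/-- Splitting off the last factor of a product over `Fin (n + 1)`. -/
def piFinSnocEquiv {n : ℕ} (F : Fin (n + 1) → Type) [∀ i, AddCommGroup (F i)]
    [∀ i, Module B (F i)] :
    (∀ i, F i) ≃ₗ[B] (∀ i : Fin n, F i.castSucc) × F (Fin.last n) where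
  toFun v := (fun i => v i.castSucc, v (Fin.last n))
  invFun x := Fin.snoc (α := F) x.1 x.2
  map_add' _ _ := rfl
  map_smul' _ _ := rfl
  left_inv v := funext fun i => by
    refine Fin.lastCases ?_ (fun i => ?_) i <;> simp
  right_inv x := by simp

/-- A product over `{0, …, p - 1}` as a product over `{1, …, p}`. -/
def piFinIccEquiv (F : ℕ → Type) [∀ i, AddCommGroup (F i)] [∀ i, Module B (F i)] (p : ℕ) :
    ((i : Fin p) → F (i + 1)) ≃ₗ[B] ((j : Finset.Icc 1 p) → F j) :=
  LinearEquiv.piCongrLeft B (fun j : Finset.Icc 1 p => F j)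
    ({ toFun := fun i => ⟨i + 1, Finset.mem_Icc.mpr (by omega)⟩
       invFun := fun j => ⟨j - 1, by have := Finset.mem_Icc.mp j.2; omega⟩
       left_inv := fun i => by simp
       right_inv := fun j => by
        have := Finset.mem_Icc.mp j.2
        ext; simp; omega } : Fin p ≃ Finset.Icc 1 p)

/-- If `F j ≅ F (p - j)`, then `F_0 × ⋯ × F_{p-1}` consists of the two middle terms `F_0`,
`F_{p/2}` and of two copies of each of the others. -/
def piFoldEquiv (F : ℕ → Type) [∀ i, AddCommGroup (F i)] [∀ i, Module B (F i)] {p r : ℕ}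
    (hp : p = (r + 1) + (r + 1)) (e : ∀ j k, j + k = p → (F j ≃ₗ[B] F k)) :
    ((i : Fin p) → F i) ≃ₗ[B] F 0 × F (r + 1) × ((j : Finset.Icc 1 r) → Fin 2 → F j) :=
  let e1 : ((i : Fin p) → F i) ≃ₗ[B]
      ((i : Fin (r + 1)) → F i) × ((i : Fin (r + 1)) → F (r + 1 + i)) :=
    (LinearEquiv.piCongrLeft B (fun i : Fin p => F i)
      (finSumFinEquiv.trans (finCongr hp.symm))).symm.trans
    (LinearEquiv.sumPiEquivProdPi B _ _ _)
  let e2 : ((i : Fin (r + 1)) → F i) ≃ₗ[B] F 0 × ((i : Fin r) → F (i + 1)) :=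
    (Fin.consLinearEquiv B (fun i : Fin (r + 1) => F i)).symm
  let e3 : ((i : Fin (r + 1)) → F (r + 1 + i)) ≃ₗ[B]
      F (r + 1) × ((i : Fin r) → F (r + 1 + (i + 1))) :=
    (Fin.consLinearEquiv B (fun i : Fin (r + 1) => F (r + 1 + i))).symm
  -- The reflection j ↦ p - j sends r + 1 + (i + 1) to r - i, which is `Fin.rev i + 1`; the upper
  -- half is therefore matched with the lower half in reverse order.
  let e4 : ((i : Fin r) → F (r + 1 + (i + 1))) ≃ₗ[B] ((i : Fin r) → F (i + 1)) :=
    (LinearEquiv.piCongrRight fun i : Fin r => e (r + 1 + (i + 1)) (Fin.rev i + 1) (by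
      rw [Fin.val_rev]; omega)).trans
    (LinearEquiv.piCongrLeft B (fun i : Fin r => F (i + 1)) Fin.revPerm)
  let e5 : (((i : Fin r) → F (i + 1)) × ((i : Fin r) → F (i + 1))) ≃ₗ[B]
      ((i : Fin r) → Fin 2 → F (i + 1)) :=
    { toFun := fun x i => ![x.1 i, x.2 i]
      invFun := fun v => (fun i => v i 0, fun i => v i 1)
      map_add' := fun x y => by ext i a; fin_cases a <;> rfl
      map_smul' := fun b x => by ext i a; fin_cases a <;> rfl
      left_inv := fun x => rfl
      right_inv := fun v => by ext i a; fin_cases a <;> rfl }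
  (e1.trans ((e2.prodCongr (e3.trans ((LinearEquiv.refl B _).prodCongr e4))).trans
    (LinearEquiv.prodProdProdComm B _ _ _ _))).trans
  ((LinearEquiv.prodAssoc B _ _ _).trans
    ((LinearEquiv.refl B _).prodCongr ((LinearEquiv.refl B _).prodCongr
      (e5.trans (piFinIccEquiv B (fun j => Fin 2 → F j) r)))))

variable {B}

variable (B) in
/-- Uncurrying a power of a product of powers. -/
def arrowPiEquiv {ι J κ : Type} (F : J → Type) [∀ i, AddCommGroup (F i)] [∀ i, Module B (F i)] :
    (ι → (j : J) → κ → F j) ≃ₗ[B] ((j : J) → ι × κ → F j) where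
  toFun v j x := v x.1 j x.2
  invFun v i j k := v j (i, k)
  map_add' _ _ := rfl
  map_smul' _ _ := rfl
  left_inv _ := rfl
  right_inv _ := rfl

/-- Two powers of the same module combine to one. -/
def arrowProdEquiv {ι κ : Type} {a : ℕ} [Fintype ι] [Fintype κ] (M : Type) [AddCommGroup M]
    [Module B M] (h : Fintype.card ι + Fintype.card κ = a) :
    ((ι → M) × (κ → M)) ≃ₗ[B] (Fin a → M) :=
  (LinearEquiv.sumArrowLequivProdArrow ι κ B M).symm.trans
    (LinearEquiv.funCongrLeft B M (Fintype.equivFinOfCardEq (by simpa using h)).symm)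

/-- Powers of a module depend on the number of copies only. -/
def arrowCardEquiv {ι : Type} {a : ℕ} [Fintype ι] (M : Type) [AddCommGroup M]
    [Module B M] (h : Fintype.card ι = a) : (ι → M) ≃ₗ[B] (Fin a → M) :=
  LinearEquiv.funCongrLeft B M (Fintype.equivFinOfCardEq h).symm

/-- Collecting isomorphic summands of an `(n + 1) × (n + 1)` array of modules, in which all
entries of the upper left `n × n` block are isomorphic to `K`, and all other entries of the last
row and the last column, except for the corner, to `X`. -/
def arrayEquiv {n : ℕ} (G : Fin (n + 1) → Fin (n + 1) → Type) [∀ a b, AddCommGroup (G a b)]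
    [∀ a b, Module B (G a b)] {K X N : Type} [AddCommGroup K] [Module B K] [AddCommGroup X]
    [Module B X] [AddCommGroup N] [Module B N]
    (eK : ∀ a b : Fin n, G a.castSucc b.castSucc ≃ₗ[B] K)
    (eX : ∀ a : Fin n, G a.castSucc (Fin.last n) ≃ₗ[B] X)
    (eX' : ∀ b : Fin n, G (Fin.last n) b.castSucc ≃ₗ[B] X)
    (eN : G (Fin.last n) (Fin.last n) ≃ₗ[B] N) :
    (∀ a b, G a b) ≃ₗ[B] (Fin (2 * n) → X) × N × (Fin n × Fin n → K) :=
  let e1 : (∀ a b, G a b) ≃ₗ[B] (Fin n → (Fin n → K) × X) × ((Fin n → X) × N) :=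
    (piFinSnocEquiv B (fun a => ∀ b, G a b)).trans
    ((LinearEquiv.piCongrRight fun a => (piFinSnocEquiv B (fun b => G a.castSucc b)).trans
      ((LinearEquiv.piCongrRight fun b => eK a b).prodCongr (eX a))).prodCongr
      ((piFinSnocEquiv B (fun b => G (Fin.last n) b)).trans
        ((LinearEquiv.piCongrRight fun b => eX' b).prodCongr eN)))
  let e2 : ((Fin n → (Fin n → K) × X) × ((Fin n → X) × N)) ≃ₗ[B]
      ((Fin n → X) × (Fin n → X)) × N × (Fin n × Fin n → K) :=
    { toFun := fun x => ((fun i => (x.1 i).2, x.2.1), x.2.2, fun i => (x.1 i.1).1 i.2)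
      invFun := fun y => (fun i => (fun j => y.2.2 (i, j), y.1.1 i), (y.1.2, y.2.1))
      map_add' := fun _ _ => rfl
      map_smul' := fun _ _ => rfl
      left_inv := fun _ => rfl
      right_inv := fun _ => rfl }
  (e1.trans e2).trans
    ((arrowProdEquiv X (by simp; ring)).prodCongr (LinearEquiv.refl B _))

end Regroup

/-! ### Collecting the blocks -/

section Collect

variable {B : Type} [CommRing B] (s t : B) {p r : ℕ}

/-- Diagonal pairs plus ordered pairs of distinct elements. This count splits the n² copies of K_0
and K_{p/2} into the n decomposed and the 2·C(n,2) undecomposed ones. -/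
theorem card_pairs (n : ℕ) : n + 2 * n.choose 2 = n * n := by
  rw [mul_comm 2, Nat.choose_two_right, Nat.div_mul_cancel (Nat.even_mul_pred_self n).two_dvd]
  cases n with
  | zero => rfl
  | succ k => simp; ring

/-- `K_0 ⊕ ⋯ ⊕ K_{p-1}`. -/
def foldK (hp : p = (r + 1) + (r + 1)) : ((i : Fin p) → Cok (matK s t p i)) ≃ₗ[B]
    Cok (matK s t p 0) × Cok (matK s t p (r + 1)) ×
      ((j : Finset.Icc 1 r) → Fin 2 → Cok (matK s t p j)) :=
  piFoldEquiv B (fun j => Cok (matK s t p j)) hp fun _ _ h => cokKSymm s t h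

/-- `N_0 ⊕ ⋯ ⊕ N_{p-1}`. -/
def foldN (hp : p = (r + 1) + (r + 1)) : ((i : Fin p) → Cok (matN s t p i)) ≃ₗ[B]
    Cok (matN s t p 0) × Cok (matN s t p (r + 1)) ×
      ((j : Finset.Icc 1 r) → Fin 2 → Cok (matN s t p j)) :=
  piFoldEquiv B (fun j => Cok (matN s t p j)) hp fun _ _ h => cokNSymm s t h

/-- The `(n+1) × (n+1)` array of blocks, with all isomorphic summands collected. -/
def collect {n : ℕ} (hp : p = (r + 1) + (r + 1))
    (G : Fin (n + 1) → Fin (n + 1) → Type) [∀ a b, AddCommGroup (G a b)]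
    [∀ a b, Module B (G a b)]
    (eK : ∀ a b : Fin n, G a.castSucc b.castSucc ≃ₗ[B] ((i : Fin p) → Cok (matK s t p i)))
    (eX : ∀ a : Fin n, G a.castSucc (Fin.last n) ≃ₗ[B] ((i : Fin p) → Cok (matX s t p (i + 1))))
    (eX' : ∀ b : Fin n, G (Fin.last n) b.castSucc ≃ₗ[B] ((i : Fin p) → Cok (matX s t p (i + 1))))
    (eN : G (Fin.last n) (Fin.last n) ≃ₗ[B] ((i : Fin p) → Cok (matN s t p i))) :
    (∀ a b, G a b) ≃ₗ[B]
      ((j : Finset.Icc 1 p) → Fin (2 * n) → Cok (matX s t p j)) ×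
      ((j : Finset.Icc 1 r) → Fin 2 → Cok (matN s t p j)) ×
      ((j : Finset.Icc 1 r) → Fin (2 * n ^ 2) → Cok (matK s t p j)) ×
      (Fin n × Fin n → Cok (matK s t p (r + 1))) ×
      (Fin n × Fin n → Cok (matK s t p 0)) ×
      Cok (matN s t p 0) × Cok (matN s t p (r + 1)) :=
  let eXX : (Fin (2 * n) → (i : Fin p) → Cok (matX s t p (i + 1))) ≃ₗ[B]
      ((j : Finset.Icc 1 p) → Fin (2 * n) → Cok (matX s t p j)) :=
    ({ toFun := fun v i a => v a i
       invFun := fun v a i => v i a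
       map_add' := fun _ _ => rfl
       map_smul' := fun _ _ => rfl
       left_inv := fun _ => rfl
       right_inv := fun _ => rfl } : (Fin (2 * n) → (i : Fin p) → Cok (matX s t p (i + 1))) ≃ₗ[B]
        ((i : Fin p) → Fin (2 * n) → Cok (matX s t p (i + 1)))).trans
    (piFinIccEquiv B (fun j => Fin (2 * n) → Cok (matX s t p j)) p)
  let eKK : (Fin n × Fin n → (j : Finset.Icc 1 r) → Fin 2 → Cok (matK s t p j)) ≃ₗ[B]
      ((j : Finset.Icc 1 r) → Fin (2 * n ^ 2) → Cok (matK s t p j)) :=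
    (arrowPiEquiv B (fun j : Finset.Icc 1 r => Cok (matK s t p j))).trans
      (LinearEquiv.piCongrRight fun j => arrowCardEquiv _ (by simp; ring))
  let e1 := (arrayEquiv G (fun a b => (eK a b).trans (foldK s t hp)) eX eX' (eN.trans (foldN s t hp)))
  let e2 : ((Fin (2 * n) → (i : Fin p) → Cok (matX s t p (i + 1))) ×
      (Cok (matN s t p 0) × Cok (matN s t p (r + 1)) ×
      ((j : Finset.Icc 1 r) → Fin 2 → Cok (matN s t p j))) ×
      (Fin n × Fin n → Cok (matK s t p 0) × Cok (matK s t p (r + 1)) ×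
      ((j : Finset.Icc 1 r) → Fin 2 → Cok (matK s t p j)))) ≃ₗ[B]
      (Fin (2 * n) → (i : Fin p) → Cok (matX s t p (i + 1))) ×
      ((j : Finset.Icc 1 r) → Fin 2 → Cok (matN s t p j)) ×
      (Fin n × Fin n → (j : Finset.Icc 1 r) → Fin 2 → Cok (matK s t p j)) ×
      (Fin n × Fin n → Cok (matK s t p (r + 1))) ×
      (Fin n × Fin n → Cok (matK s t p 0)) ×
      Cok (matN s t p 0) × Cok (matN s t p (r + 1)) :=
    { toFun := fun x => (x.1, x.2.1.2.2, fun i => (x.2.2 i).2.2, fun i => (x.2.2 i).2.1,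
        fun i => (x.2.2 i).1, x.2.1.1, x.2.1.2.1)
      invFun := fun y => (y.1, (y.2.2.2.2.2.1, y.2.2.2.2.2.2, y.2.1),
        fun i => (y.2.2.2.2.1 i, y.2.2.2.1 i, y.2.2.1 i))
      map_add' := fun _ _ => rfl
      map_smul' := fun _ _ => rfl
      left_inv := fun _ => rfl
      right_inv := fun _ => rfl }
  (e1.trans e2).trans (eXX.prodCongr ((LinearEquiv.refl B _).prodCongr
    (eKK.prodCongr (LinearEquiv.refl B _))))

end Collect

/-! ### Elements of `G(m,p,2)` and the support of invariant polynomials -/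

theorem exists_mem_Gmpn {m p n : ℕ} (w : Equiv.Perm (Fin n)) (d : Fin n → ℂˣ)
    (hd : ∀ i, d i ^ m = 1) (hd' : (∏ i, d i) ^ (m / p) = 1) :
    ∃ g ∈ Gmpn m p n, (g : Matrix (Fin n) (Fin n) ℂ)
      = w.permMatrix ℂ * Matrix.diagonal (fun i => (d i : ℂ)) := by
  have hdet : (w.permMatrix ℂ * Matrix.diagonal (fun i => (d i : ℂ))).det ≠ 0 := by
    rw [Matrix.det_mul, Matrix.det_permutation, Matrix.det_diagonal]
    refine mul_ne_zero ?_ (Finset.prod_ne_zero_iff.mpr fun i _ => (d i).ne_zero)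
    exact_mod_cast (Equiv.Perm.sign w).ne_zero
  exact ⟨Matrix.GeneralLinearGroup.mkOfDetNeZero _ hdet, ⟨w, d, hd, hd', rfl⟩, rfl⟩

theorem subst_X {n : ℕ} {g : Matrix.GeneralLinearGroup (Fin n) ℂ} {w : Equiv.Perm (Fin n)}
    {d : Fin n → ℂˣ} (hg : (g : Matrix (Fin n) (Fin n) ℂ)
      = w.permMatrix ℂ * Matrix.diagonal (fun i => (d i : ℂ))) (i : Fin n) :
    subst g (X i) = C (d (w i) : ℂ) * X (w i) := by
  simp only [subst, aeval_X, hg, perm_mul_diagonal_apply, apply_ite C, C_0, ite_mul, zero_mul,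
      Finset.sum_ite_eq, Finset.mem_univ, if_true]

/-- The diagonal matrices in `G(m,p,2)`. -/
theorem exists_mem_diag {m p : ℕ} (a b : ℂˣ) (ha : a ^ m = 1) (hb : b ^ m = 1)
    (hab : (a * b) ^ (m / p) = 1) :
    ∃ g ∈ Gmpn m p 2, (g : Matrix (Fin 2) (Fin 2) ℂ) = !![(a : ℂ), 0; 0, (b : ℂ)] ∧
      subst g (X 0) = C (a : ℂ) * X 0 ∧ subst g (X 1) = C (b : ℂ) * X 1 := by
  obtain ⟨g, hg, hg'⟩ := exists_mem_Gmpn (m := m) (p := p) (n := 2) 1 ![a, b]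
    (by intro i; fin_cases i <;> simp [ha, hb]) (by simp [Fin.prod_univ_two, hab])
  refine ⟨g, hg, ?_, by simpa using subst_X hg' 0, by simpa using subst_X hg' 1⟩
  rw [hg']
  ext i j; fin_cases i <;> fin_cases j <;> simp

/-- The antidiagonal matrices in `G(m,p,2)`. -/
theorem exists_mem_antidiag {m p : ℕ} (a b : ℂˣ) (ha : a ^ m = 1) (hb : b ^ m = 1)
    (hab : (a * b) ^ (m / p) = 1) :
    ∃ g ∈ Gmpn m p 2, (g : Matrix (Fin 2) (Fin 2) ℂ) = !![0, (a : ℂ); (b : ℂ), 0] ∧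
      subst g (X 0) = C (a : ℂ) * X 1 ∧ subst g (X 1) = C (b : ℂ) * X 0 := by
  -- The diagonal factor scales columns, so the entry `a`, which sits in column 1, is the second
  -- entry of `![b, a]`.
  obtain ⟨g, hg, hg'⟩ := exists_mem_Gmpn (m := m) (p := p) (n := 2) (Equiv.swap 0 1) ![b, a]
    (by intro i; fin_cases i <;> simp [ha, hb]) (by simp [Fin.prod_univ_two, mul_comm b a, hab])
  refine ⟨g, hg, ?_, by simpa using subst_X hg' 0, by simpa using subst_X hg' 1⟩
  rw [hg']
  ext i j; rw [perm_mul_diagonal_apply]; fin_cases i <;> fin_cases j <;> simp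

theorem monomial_fin_two {A : Type} [CommSemiring A] (u : Fin 2 →₀ ℕ) (a : A) :
    monomial u a = C a * (X 0 ^ u 0 * X 1 ^ u 1) := by
  rw [monomial_eq, Finsupp.prod_fintype _ _ (by simp), Fin.prod_univ_two]

/-- Monomials are eigenvectors of diagonal substitutions, so invariance becomes a condition on the
support. -/
theorem coeff_of_scaling (φ : MvPolynomial (Fin 2) ℂ →ₐ[ℂ] MvPolynomial (Fin 2) ℂ) {a b : ℂ}
    (h0 : φ (X 0) = C a * X 0) (h1 : φ (X 1) = C b * X 1) (f : MvPolynomial (Fin 2) ℂ)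
    (d : Fin 2 →₀ ℕ) : coeff d (φ f) = a ^ d 0 * b ^ d 1 * coeff d f := by
  induction f using MvPolynomial.induction_on' with
  | monomial u c =>
    have : φ (monomial u c) = monomial u (a ^ u 0 * b ^ u 1 * c) := by
      have hC : φ (C c) = C c := φ.commutes c
      rw [monomial_fin_two, monomial_fin_two, map_mul, map_mul, map_pow, map_pow, h0, h1, hC]
      simp only [C_mul, C_pow]
      ring
    rw [this, coeff_monomial, coeff_monomial]
    split_ifs with h
    · rw [h]
    · simp
  | add f g hf hg => rw [map_add, coeff_add, coeff_add, hf, hg]; ring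

/-- Weights of `x` and `y` recording the character of the diagonal subgroup of `G(pq,p,2)`. -/
def wt (p q : ℕ) : Fin 2 → ZMod q × ZMod (p * q) := ![(0, 1), (1, -1)]

theorem weight_wt (p q : ℕ) (d : Fin 2 →₀ ℕ) :
    Finsupp.weight (wt p q) d = ((d 1 : ZMod q), (d 0 : ZMod (p * q)) - d 1) := by
  rw [Finsupp.weight_apply, Finsupp.sum_fintype _ _ (by simp), Fin.sum_univ_two]
  ext <;> simp [wt, sub_eq_add_neg]

theorem isWeightedHomogeneous_XX (p q a b : ℕ) :
    IsWeightedHomogeneous (wt p q) (X 0 ^ a * X 1 ^ b : MvPolynomial (Fin 2) ℂ)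
      ((b : ZMod q), (a : ZMod (p * q)) - b) := by
  have h := ((isWeightedHomogeneous_X ℂ (wt p q) 0).pow a).mul
    ((isWeightedHomogeneous_X ℂ (wt p q) 1).pow b)
  convert h using 1
  ext <;> simp [wt, sub_eq_add_neg]

theorem exists_unit_primitiveRoot {n : ℕ} (hn : n ≠ 0) : ∃ ζ : ℂˣ, IsPrimitiveRoot (ζ : ℂ) n := by
  have h := Complex.isPrimitiveRoot_exp n hn
  exact ⟨(h.isUnit hn).unit, h⟩

section Invariants

variable {p q : ℕ} (hp : 0 < p) (hq : 0 < q)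
include hp hq

omit hq in
theorem coe_sigma1 : (sigma1 (p * q) p : MvPolynomial (Fin 2) ℂ) = (X 0 * X 1) ^ q := by
  simp [sigma1, Nat.mul_div_cancel_left _ hp]

/-- Two families of diagonal matrices suffice: with ζ a primitive pq-th root of unity, diag(1, ζ^p)
gives the first divisibility and diag(ζ, ζ⁻¹) the second. -/
theorem dvd_of_coeff_ne_zero {f : MvPolynomial (Fin 2) ℂ} (hf : f ∈ R (p * q) p)
    {d : Fin 2 →₀ ℕ} (hd : coeff d f ≠ 0) : q ∣ d 1 ∧ ((p * q : ℕ) : ℤ) ∣ d 0 - d 1 := by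
  have hm : p * q ≠ 0 := (Nat.mul_pos hp hq).ne'
  obtain ⟨ζ, hζ⟩ := exists_unit_primitiveRoot hm
  have hζm : ζ ^ (p * q) = 1 := Units.ext (by simpa using hζ.pow_eq_one)
  have key : ∀ a b : ℂˣ, a ^ (p * q) = 1 → b ^ (p * q) = 1 → (a * b) ^ q = 1 →
      a ^ d 0 * b ^ d 1 = 1 := fun a b ha hb hab => by
    obtain ⟨g, hg, -, h0, h1⟩ := exists_mem_diag (m := p * q) (p := p) a b ha hb
      (by rwa [Nat.mul_div_cancel_left _ hp])
    have := coeff_of_scaling (subst g) h0 h1 f d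
    rw [hf g hg] at this
    have h2 : ((a : ℂ) ^ d 0 * (b : ℂ) ^ d 1) = 1 := by
      have : ((a : ℂ) ^ d 0 * (b : ℂ) ^ d 1 - 1) * coeff d f = 0 := by linear_combination -this
      rcases mul_eq_zero.mp this with h | h
      · linear_combination h
      · exact absurd h hd
    exact Units.ext (by simpa using h2)
  constructor
  · have h := key 1 (ζ ^ p) (by simp) (by rw [← pow_mul, mul_comm, pow_mul, hζm, one_pow])
      (by rw [one_mul, ← pow_mul, hζm])
    rw [one_pow, one_mul, ← pow_mul] at h
    have h' : (ζ : ℂ) ^ (p * d 1) = 1 := by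
      rw [← Units.val_pow_eq_pow_val, h, Units.val_one]
    exact (Nat.mul_dvd_mul_iff_left hp).mp ((hζ.pow_eq_one_iff_dvd _).mp h')
  · have h := key ζ ζ⁻¹ hζm (by rw [inv_pow, hζm, inv_one]) (by simp)
    have h' : (ζ : ℂ) ^ ((d 0 : ℤ) - d 1) = 1 := by
      rw [zpow_sub₀ ζ.ne_zero, zpow_natCast, zpow_natCast]
      have := congrArg Units.val h
      simpa [div_eq_mul_inv] using this
    exact (hζ.zpow_eq_one_iff_dvd _).mp h'

/-- Multiplication by elements of `R` thus preserves weights, so `R`-linear relations can be tested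
one weight at a time. -/
theorem isWeightedHomogeneous_of_mem {f : MvPolynomial (Fin 2) ℂ} (hf : f ∈ R (p * q) p) :
    IsWeightedHomogeneous (wt p q) f 0 := by
  intro d hd
  obtain ⟨h1, h2⟩ := dvd_of_coeff_ne_zero hp hq hf hd
  rw [weight_wt]
  refine Prod.ext ?_ ?_
  · exact (ZMod.natCast_eq_zero_iff _ _).mpr h1
  · have := (ZMod.intCast_zmod_eq_zero_iff_dvd _ _).mpr h2
    simpa using this

omit hp hq in
theorem rename_swap_of_mem {f : MvPolynomial (Fin 2) ℂ} (hf : f ∈ R (p * q) p) :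
    rename (Equiv.swap (0 : Fin 2) 1) f = f := by
  obtain ⟨g, hg, -, h0, h1⟩ := exists_mem_antidiag (m := p * q) (p := p) 1 1 (by simp) (by simp)
    (by simp)
  have : rename (Equiv.swap (0 : Fin 2) 1) = subst g := by
    refine MvPolynomial.algHom_ext fun i => ?_
    fin_cases i
    · simpa using h0.symm
    · simpa using h1.symm
  rw [this]
  exact hf g hg

end Invariants

/-! ### `S` is a free module over the invariant ring -/

section Free

variable (p q : ℕ)

/-- The number of times `x^q` is split off in the first basis vector. -/
def kk (a b κ : ℕ) : ℕ := κ + if a < b then 1 else 0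

/-- The first of the two basis elements of an isotypic component. -/
def bf (a b κ : ℕ) : MvPolynomial (Fin 2) ℂ := X 0 ^ (a + q * kk a b κ) * X 1 ^ b

/-- The second of the two basis elements of an isotypic component. -/
def bg (a b κ : ℕ) : MvPolynomial (Fin 2) ℂ := X 0 ^ a * X 1 ^ (b + q * (p - kk a b κ))

variable {p q} (hp : 0 < p) (hq : 0 < q)
include hp hq

/-- Strong induction on the degree. If both exponents are at least q, σ₁ divides off. Otherwise one
exponent is below q, and either the other is in the range of the given monomials or σ₂ lowers it by
m = qp. -/
theorem span_aux (T : Submodule (R (p * q) p) (MvPolynomial (Fin 2) ℂ))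
    (hf : ∀ a b k, a < q → b < q → (b ≤ a → k < p) → (a < b → 1 ≤ k ∧ k ≤ p) →
      X 0 ^ (a + q * k) * X 1 ^ b ∈ T)
    (hg : ∀ a b k, a < q → b < q → (b ≤ a → k < p) → (a < b → 1 ≤ k ∧ k ≤ p) →
      X 0 ^ a * X 1 ^ (b + q * (p - k)) ∈ T) (N : ℕ) :
    ∀ a b, a + b = N → X 0 ^ a * X 1 ^ b ∈ T := by
  have hs : ∀ a b, X 0 ^ a * X 1 ^ b ∈ T → X 0 ^ (a + q) * X 1 ^ (b + q) ∈ T := fun a b h => by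
    have := T.smul_mem (sigma1 (p * q) p) h
    rw [Subalgebra.smul_def, smul_eq_mul, coe_sigma1 hp] at this
    convert this using 1; ring
  have htx : ∀ a b, X 0 ^ a * X 1 ^ b ∈ T → X 0 ^ a * X 1 ^ (b + q * p) ∈ T →
      X 0 ^ (a + q * p) * X 1 ^ b ∈ T := fun a b h h' => by
    have := T.sub_mem (T.smul_mem (sigma2 (p * q) p) h) h'
    rw [Subalgebra.smul_def, smul_eq_mul] at this
    convert this using 1; simp only [sigma2]; ring
  have hty : ∀ a b, X 0 ^ a * X 1 ^ b ∈ T → X 0 ^ (a + q * p) * X 1 ^ b ∈ T →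
      X 0 ^ a * X 1 ^ (b + q * p) ∈ T := fun a b h h' => by
    have := T.sub_mem (T.smul_mem (sigma2 (p * q) p) h) h'
    rw [Subalgebra.smul_def, smul_eq_mul] at this
    convert this using 1; simp only [sigma2]; ring
  have hm : 0 < q * p := Nat.mul_pos hq hp
  induction N using Nat.strong_induction_on with
  | _ N ih =>
    intro a b hN
    by_cases hab : q ≤ a ∧ q ≤ b
    · have := hs _ _ (ih (a - q + (b - q)) (by omega) (a - q) (b - q) rfl)
      rwa [Nat.sub_add_cancel hab.1, Nat.sub_add_cancel hab.2] at this
    rcases lt_or_ge b q with hb | hb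
    · obtain ⟨α, A, hα, rfl⟩ : ∃ α A, α < q ∧ a = α + q * A :=
        ⟨a % q, a / q, Nat.mod_lt _ hq, (Nat.mod_add_div a q).symm⟩
      rcases lt_trichotomy A p with hA | rfl | hA
      · rcases le_or_gt b α with h | h
        · exact hf α b A hα hb (fun _ => hA) (by omega)
        · rcases Nat.eq_zero_or_pos A with rfl | hA0
          · simpa using hg α b p hα hb (by omega) (by omega)
          · exact hf α b A hα hb (by omega) (by omega)
      · rcases le_or_gt b α with h | h
        -- For b ≤ α the value k = p is not allowed, but x^(α+m) y^b is σ₂ x^α y^b minus x^α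
        -- y^(b+m), and these two monomials are the given ones with k = 0.
        · have h1 := hf α b 0 hα hb (by omega) (by omega)
          have h2 := hg α b 0 hα hb (by omega) (by omega)
          exact htx α b (by simpa using h1) (by simpa using h2)
        · exact hf α b A hα hb (by omega) (by omega)
      · obtain ⟨D, rfl⟩ := Nat.exists_eq_add_of_lt hA
        have e1 : α + q * (p + D + 1) = (α + q * (D + 1)) + q * p := by ring
        have h2 : q ≤ α + q * (D + 1) := by nlinarith
        have h3 : q ≤ b + q * p := by nlinarith
        rw [e1] at hN ⊢
        -- Subtracting the monomial from σ₂ times one of lower degree leaves a monomial of the same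
        -- degree, but with both exponents at least q; it is σ₁ times a monomial of lower degree.
        refine htx _ _ (ih (α + q * (D + 1) + b) (by omega) _ _ rfl) ?_
        have := hs _ _ (ih (α + q * (D + 1) - q + (b + q * p - q)) (by omega) _ _ rfl)
        rwa [Nat.sub_add_cancel h2, Nat.sub_add_cancel h3] at this
    · have ha : a < q := by omega
      obtain ⟨β, D, hβ, rfl⟩ : ∃ β D, β < q ∧ b = β + q * D :=
        ⟨b % q, b / q, Nat.mod_lt _ hq, (Nat.mod_add_div b q).symm⟩
      have hD0 : D ≠ 0 := by rintro rfl; omega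
      rcases lt_trichotomy D p with hD | rfl | hD
      · have := hg a β (p - D) ha hβ (by omega) (by omega)
        rwa [show p - (p - D) = D by omega] at this
      · rcases le_or_gt β a with h | h
        · simpa using hg a β 0 ha hβ (by omega) (by omega)
        · have h1 := hg a β D ha hβ (by omega) (by omega)
          have h2 := hf a β D ha hβ (by omega) (by omega)
          exact hty a β (by simpa using h1) h2
      · obtain ⟨E, rfl⟩ := Nat.exists_eq_add_of_lt hD
        have e1 : β + q * (p + E + 1) = (β + q * (E + 1)) + q * p := by ring
        have h2 : q ≤ β + q * (E + 1) := by nlinarith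
        have h3 : q ≤ a + q * p := by nlinarith
        rw [e1] at hN ⊢
        refine hty _ _ (ih (a + (β + q * (E + 1))) (by omega) _ _ rfl) ?_
        have := hs _ _ (ih (a + q * p - q + (β + q * (E + 1) - q)) (by omega) _ _ rfl)
        rwa [Nat.sub_add_cancel h2, Nat.sub_add_cancel h3] at this

theorem span_basis (T : Submodule (R (p * q) p) (MvPolynomial (Fin 2) ℂ))
    (hf : ∀ a b κ, a < q → b < q → κ < p → bf q a b κ ∈ T)
    (hg : ∀ a b κ, a < q → b < q → κ < p → bg p q a b κ ∈ T) : T = ⊤ := by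
  -- The admissible k are 0, …, p-1 if b ≤ a and 1, …, p if a < b; `kk` parametrizes both ranges by
  -- κ < p.
  have hk : ∀ a b k, (b ≤ a → k < p) → (a < b → 1 ≤ k ∧ k ≤ p) →
      ∃ κ < p, kk a b κ = k := fun a b k h h' => by
    rcases le_or_gt b a with hab | hab
    · exact ⟨k, h hab, by simp [kk, hab.not_gt]⟩
    · exact ⟨k - 1, by have := h' hab; omega, by have := h' hab; simp [kk, hab]; omega⟩
  have key := span_aux hp hq T
    (fun a b k ha hb h h' => by
      obtain ⟨κ, hκ, rfl⟩ := hk a b k h h'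
      exact hf a b κ ha hb hκ)
    (fun a b k ha hb h h' => by
      obtain ⟨κ, hκ, rfl⟩ := hk a b k h h'
      exact hg a b κ ha hb hκ)
  rw [eq_top_iff]
  rintro f -
  induction f using MvPolynomial.induction_on' with
  | monomial u c =>
    rw [monomial_fin_two]
    have := T.smul_mem (algebraMap ℂ (R (p * q) p) c) (key _ (u 0) (u 1) rfl)
    rwa [Subalgebra.smul_def, smul_eq_mul] at this
  | add f g hf hg => exact T.add_mem hf hg

end Free

/-! ### The monomial basis of `S` over `R` and multiplication by `z` -/

section Basis

variable {p n : ℕ}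

/-- The cyclic successor on `{0, …, n}`. -/
def nx (n a : ℕ) : ℕ := if a = n then 0 else a + 1

/-- Whether the cyclic successor wraps around. -/
def wr (n a : ℕ) : ℕ := if a = n then 1 else 0

theorem nx_add_wr (n a : ℕ) : nx n a + (n + 1) * wr n a = a + 1 := by
  unfold nx wr; split_ifs with h <;> simp [h]

/-- Multiplication by xy does not change the exponent difference a + qk - b. Since wrapping lowers a
coordinate by q, comparing this difference before and after the shift gives the change of k. -/
theorem kk_nx {a b : ℕ} (ha : a ≤ n) (hb : b ≤ n) (κ : ℕ) :
    kk (nx n a) (nx n b) κ + wr n b = kk a b κ + wr n a := by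
  unfold kk nx wr; split_ifs <;> omega

theorem kk_le (a b : ℕ) {κ : ℕ} (h : κ < p) : kk a b κ ≤ p := by
  unfold kk; split_ifs <;> omega

theorem coe_finRotate_eq (a : Fin (n + 1)) : (finRotate (n + 1) a : ℕ) = nx n a := by
  unfold nx
  split_ifs with h
  · obtain rfl : a = Fin.last n := Fin.ext h
    simp
  · exact coe_finRotate_of_ne_last fun h' => h (by rw [h']; rfl)

/-- When b wraps, the surplus y^q is paired with an x^q into a factor σ₁. When a wraps, the surplus
x^q is absorbed by the larger k. For `bg` the roles of the two coordinates are exchanged. -/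
theorem X_mul_bf {a b κ : ℕ} (ha : a ≤ n) (hb : b ≤ n) :
    X 0 * X 1 * bf (n + 1) a b κ =
      ((X 0 * X 1) ^ (n + 1)) ^ wr n b * bf (n + 1) (nx n a) (nx n b) κ := by
  have h1 := nx_add_wr n a
  have h2 := nx_add_wr n b
  have h3 := congrArg ((n + 1) * ·) (kk_nx ha hb κ)
  simp only [mul_add] at h3
  have e1 : a + (n + 1) * kk a b κ + 1
      = (n + 1) * wr n b + (nx n a + (n + 1) * kk (nx n a) (nx n b) κ) := by omega
  have e2 : b + 1 = (n + 1) * wr n b + nx n b := by omega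
  calc X 0 * X 1 * bf (n + 1) a b κ
      = X 0 ^ (a + (n + 1) * kk a b κ + 1) * X 1 ^ (b + 1) := by rw [bf]; ring
    _ = _ := by rw [e1, e2, bf, ← pow_mul, pow_add, pow_add, mul_pow]; ring

theorem X_mul_bg {a b κ : ℕ} (ha : a ≤ n) (hb : b ≤ n) (hκ : κ < p) :
    X 0 * X 1 * bg p (n + 1) a b κ =
      ((X 0 * X 1) ^ (n + 1)) ^ wr n a * bg p (n + 1) (nx n a) (nx n b) κ := by
  have h1 := nx_add_wr n a
  have h2 := nx_add_wr n b
  have h4 := kk_nx ha hb κ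
  have h5 := kk_le a b hκ
  have h6 := kk_le (nx n a) (nx n b) hκ
  have h3 := congrArg ((n + 1) * ·)
    (show (p - kk a b κ) + wr n b = (p - kk (nx n a) (nx n b) κ) + wr n a by omega)
  simp only [mul_add] at h3
  have e1 : b + (n + 1) * (p - kk a b κ) + 1
      = (n + 1) * wr n a + (nx n b + (n + 1) * (p - kk (nx n a) (nx n b) κ)) := by omega
  have e2 : a + 1 = (n + 1) * wr n a + nx n a := by omega
  calc X 0 * X 1 * bg p (n + 1) a b κ
      = X 0 ^ (a + 1) * X 1 ^ (b + (n + 1) * (p - kk a b κ) + 1) := by rw [bg]; ring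
    _ = _ := by rw [e1, e2, bg, ← pow_mul, pow_add, pow_add, mul_pow]; ring

variable {q : ℕ}

/-- Split y^m = y^(qk) y^(q(p-k)): the first factor joins x^(qk) to form σ₁^k, the second turns `bf`
into `bg`. Together with `X_pow_mul_bg` this gives the off-diagonal entries of the blocks. -/
theorem Y_pow_mul_bf (a b : ℕ) {κ : ℕ} (hκ : κ < p) :
    X 1 ^ (p * q) * bf q a b κ = ((X 0 * X 1) ^ q) ^ kk a b κ * bg p q a b κ := by
  have h := kk_le a b hκ
  obtain ⟨l, hl⟩ := Nat.exists_eq_add_of_le h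
  rw [bf, bg, show p - kk a b κ = l by omega, show p * q = (kk a b κ + l) * q by rw [← hl]]
  ring

theorem X_pow_mul_bg (a b : ℕ) {κ : ℕ} (hκ : κ < p) :
    X 0 ^ (p * q) * bg p q a b κ = ((X 0 * X 1) ^ q) ^ (p - kk a b κ) * bf q a b κ := by
  have h := kk_le a b hκ
  obtain ⟨l, hl⟩ := Nat.exists_eq_add_of_le h
  rw [bf, bg, show p - kk a b κ = l by omega, show p * q = (kk a b κ + l) * q by rw [← hl]]
  ring

/-- The matrix of multiplication by `z` from one isotypic component to the next. -/
def blockMat {B : Type} [CommRing B] (s t : B) (p ea eb k : ℕ) : Matrix (Fin 2) (Fin 2) B :=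
  !![s ^ eb * t, 2 * s ^ (ea + (p - k)); -2 * s ^ (eb + k), -(s ^ ea * t)]

/-- Neither x^m nor y^m is in `R`, so x^m - y^m is written as σ₂ - 2y^m on `bf` and as 2x^m - σ₂ on
`bg`; the leftover power carries one basis monomial to an `R`-multiple of the other. -/
theorem z_mul_bf {a b κ : ℕ} (ha : a ≤ n) (hb : b ≤ n) (hκ : κ < p) :
    z (p * (n + 1)) * bf (n + 1) a b κ =
      ((X 0 * X 1) ^ (n + 1)) ^ wr n b * (X 0 ^ (p * (n + 1)) + X 1 ^ (p * (n + 1))) *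
        bf (n + 1) (nx n a) (nx n b) κ +
      (-2 * ((X 0 * X 1) ^ (n + 1)) ^ (wr n b + kk (nx n a) (nx n b) κ)) *
        bg p (n + 1) (nx n a) (nx n b) κ := by
  have h1 := X_mul_bf (κ := κ) ha hb
  have h2 := Y_pow_mul_bf (p := p) (q := n + 1) (nx n a) (nx n b) hκ
  rw [z, pow_add]
  linear_combination (X 0 ^ (p * (n + 1)) - X 1 ^ (p * (n + 1))) * h1 -
    2 * ((X 0 * X 1) ^ (n + 1)) ^ wr n b * h2

theorem z_mul_bg {a b κ : ℕ} (ha : a ≤ n) (hb : b ≤ n) (hκ : κ < p) :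
    z (p * (n + 1)) * bg p (n + 1) a b κ =
      (2 * ((X 0 * X 1) ^ (n + 1)) ^ (wr n a + (p - kk (nx n a) (nx n b) κ))) *
        bf (n + 1) (nx n a) (nx n b) κ +
      -(((X 0 * X 1) ^ (n + 1)) ^ wr n a * (X 0 ^ (p * (n + 1)) + X 1 ^ (p * (n + 1)))) *
        bg p (n + 1) (nx n a) (nx n b) κ := by
  have h1 := X_mul_bg ha hb hκ
  have h2 := X_pow_mul_bg (p := p) (q := n + 1) (nx n a) (nx n b) hκ
  rw [z, pow_add]
  linear_combination (X 0 ^ (p * (n + 1)) - X 1 ^ (p * (n + 1))) * h1 +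
    2 * ((X 0 * X 1) ^ (n + 1)) ^ wr n a * h2

/-- The index set of the isotypic components. -/
abbrev Idx (p q : ℕ) : Type := Fin q × Fin q × Fin p

/-- The linear combination of the basis elements with given coefficients. -/
def comb (p q : ℕ) :
    (Idx p q → Fin 2 → R (p * q) p) →ₗ[R (p * q) p] MvPolynomial (Fin 2) ℂ where
  toFun v := ∑ i, ((v i 0 : MvPolynomial (Fin 2) ℂ) * bf q i.1 i.2.1 i.2.2 +
    (v i 1 : MvPolynomial (Fin 2) ℂ) * bg p q i.1 i.2.1 i.2.2)
  map_add' v w := by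
    rw [← Finset.sum_add_distrib]
    refine Finset.sum_congr rfl fun i _ => ?_
    simp only [Pi.add_apply, AddMemClass.coe_add]; ring
  map_smul' r v := by
    change _ = (r : MvPolynomial (Fin 2) ℂ) * ∑ i, _
    rw [Finset.mul_sum]
    refine Finset.sum_congr rfl fun i _ => ?_
    simp only [Pi.smul_apply, smul_eq_mul, MulMemClass.coe_mul]; ring

/-- The weight of the two basis elements of an isotypic component. -/
def idxWt (i : Idx p q) : ZMod q × ZMod (p * q) :=
  ((i.2.1 : ℕ), ((i.1 : ℕ) + q * kk i.1 i.2.1 i.2.2 : ℕ) - ((i.2.1 : ℕ) : ZMod (p * q)))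

theorem isWeightedHomogeneous_bf (i : Idx p q) :
    IsWeightedHomogeneous (wt p q) (bf q i.1 i.2.1 i.2.2) (idxWt i) :=
  isWeightedHomogeneous_XX _ _ _ _

/-- Passing from `bf` to `bg` raises the y-exponent by a multiple of q and lowers the exponent
difference by exactly pq, so both weight components are unchanged. -/
theorem isWeightedHomogeneous_bg (i : Idx p q) :
    IsWeightedHomogeneous (wt p q) (bg p q i.1 i.2.1 i.2.2) (idxWt i) := by
  have h := isWeightedHomogeneous_XX p q i.1 (i.2.1 + q * (p - kk i.1 i.2.1 i.2.2))
  rw [bg]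
  convert h using 1
  obtain ⟨l, hl⟩ := Nat.exists_eq_add_of_le (kk_le i.1 i.2.1 i.2.2.2)
  have hz : ((q * kk i.1 i.2.1 i.2.2 + q * l : ℕ) : ZMod (p * q)) = 0 := by
    rw [← mul_add, ← hl, mul_comm]; exact ZMod.natCast_self _
  have hl' : p - kk i.1 i.2.1 i.2.2 = l := by omega
  rw [hl', idxWt]
  refine Prod.ext ?_ ?_
  · simp
  · push_cast at hz ⊢
    linear_combination hz

/-- The first component determines b < q. For fixed b the x-exponent a + qk lies in the window [b, b
+ pq), which is the reason for the shift in `kk`; so its residue modulo pq determines it, and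
division by q recovers a and κ. -/
theorem idxWt_injective (hq : 0 < q) : Function.Injective (idxWt (p := p) (q := q)) := by
  rintro ⟨a, b, κ⟩ ⟨a', b', κ'⟩ h
  obtain ⟨h1, h2⟩ := Prod.mk.inj h
  have hb : (b : ℕ) = b' := by
    have := (ZMod.natCast_eq_natCast_iff' _ _ _).mp h1
    rwa [Nat.mod_eq_of_lt b.2, Nat.mod_eq_of_lt b'.2] at this
  simp only [hb, sub_left_inj] at h2
  have h3 := (ZMod.natCast_eq_natCast_iff _ _ _).mp h2
  have hwin : ∀ a κ : ℕ, a < q → κ < p → (b' : ℕ) ≤ a + q * kk a b' κ ∧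
      a + q * kk a b' κ < b' + p * q := fun a κ ha hκ => by
    have hb' := b'.2
    unfold kk
    split_ifs with hab
    · have : q * (κ + 1) ≤ q * p := Nat.mul_le_mul_left q (by omega)
      rw [mul_comm p q]
      have : q * (κ + 1) = q * κ + q := by ring
      constructor <;> omega
    · have : q * (κ + 1) ≤ q * p := Nat.mul_le_mul_left q (by omega)
      rw [mul_comm p q]
      have : q * (κ + 1) = q * κ + q := by ring
      constructor
      · have := Nat.zero_le (q * (κ + 0)); omega
      · rw [add_zero]; omega
  have w1 := hwin a κ a.2 κ.2
  have w2 := hwin a' κ' a'.2 κ'.2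
  have h4 : (a : ℕ) + q * kk a b' κ = a' + q * kk a' b' κ' := by
    generalize (a : ℕ) + q * kk a b' κ = A at *
    generalize (a' : ℕ) + q * kk a' b' κ' = A' at *
    obtain ⟨u, rfl⟩ := Nat.exists_eq_add_of_le w1.1
    obtain ⟨v, rfl⟩ := Nat.exists_eq_add_of_le w2.1
    have := Nat.ModEq.add_left_cancel' _ h3
    rw [Nat.ModEq, Nat.mod_eq_of_lt (by omega), Nat.mod_eq_of_lt (by omega)] at this
    rw [this]
  have ha : (a : ℕ) = a' := by
    have := congrArg (· % q) h4
    simpa [Nat.mod_eq_of_lt a.2, Nat.mod_eq_of_lt a'.2] using this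
  rw [ha] at h4
  have h5 := Nat.eq_of_mul_eq_mul_left hq (Nat.add_left_cancel h4)
  have hκ : (κ : ℕ) = κ' := by unfold kk at h5; omega
  rw [Fin.ext ha, Fin.ext hb, Fin.ext hκ]

theorem X_pow_sub_ne_zero {m : ℕ} (hm : 0 < m) :
    (X 0 ^ m - X 1 ^ m : MvPolynomial (Fin 2) ℂ) ≠ 0 := fun h => by
  have := congrArg (eval ![(1 : ℂ), 0]) h
  simp [hm.ne'] at this

/-- Cramer's rule: r and r' are fixed by the swap of x and y, so applying the swap gives a second
equation, and the determinant of the system is a nonzero multiple of x^m - y^m. -/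
theorem eq_zero_of_comb_pair (hp : 0 < p) (hq : 0 < q) (a b : ℕ) {κ : ℕ} (hκ : κ < p)
    {r r' : MvPolynomial (Fin 2) ℂ} (hr : r ∈ R (p * q) p) (hr' : r' ∈ R (p * q) p)
    (h : r * bf q a b κ + r' * bg p q a b κ = 0) : r = 0 ∧ r' = 0 := by
  have h' := congrArg (rename (Equiv.swap (0 : Fin 2) 1)) h
  rw [map_add, map_mul, map_mul, rename_swap_of_mem hr, rename_swap_of_mem hr', map_zero] at h'
  obtain ⟨l, hl⟩ := Nat.exists_eq_add_of_le (kk_le a b hκ)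
  have hdet : bf q a b κ * rename (Equiv.swap (0 : Fin 2) 1) (bg p q a b κ) -
      bg p q a b κ * rename (Equiv.swap (0 : Fin 2) 1) (bf q a b κ)
      = (X 0 * X 1) ^ (a + b) * (X 0 ^ (p * q) - X 1 ^ (p * q)) := by
    simp only [bf, bg, map_mul, map_pow, rename_X, Equiv.swap_apply_left, Equiv.swap_apply_right]
    rw [show p - kk a b κ = l by omega, show p * q = (kk a b κ + l) * q by rw [← hl]]
    ring
  have hne : (X 0 * X 1) ^ (a + b) * (X 0 ^ (p * q) - X 1 ^ (p * q) : MvPolynomial (Fin 2) ℂ) ≠ 0 :=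
    mul_ne_zero (pow_ne_zero _ (mul_ne_zero (X_ne_zero _) (X_ne_zero _)))
      (X_pow_sub_ne_zero (Nat.mul_pos hp hq))
  rw [← hdet] at hne
  constructor
  · refine (mul_eq_zero.mp (?_ : r * _ = 0)).resolve_right hne
    linear_combination rename (Equiv.swap (0 : Fin 2) 1) (bg p q a b κ) * h - bg p q a b κ * h'
  · refine (mul_eq_zero.mp (?_ : r' * _ = 0)).resolve_right hne
    linear_combination bf q a b κ * h' - rename (Equiv.swap (0 : Fin 2) 1) (bf q a b κ) * h

/-- Different indices have different weights, so taking the component of one weight isolates a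
single pair. -/
theorem comb_injective (hp : 0 < p) (hq : 0 < q) : Function.Injective (comb p q) := by
  rw [injective_iff_map_eq_zero]
  intro v hv
  have hhom : ∀ i, IsWeightedHomogeneous (wt p q)
      ((v i 0 : MvPolynomial (Fin 2) ℂ) * bf q i.1 i.2.1 i.2.2 +
        (v i 1 : MvPolynomial (Fin 2) ℂ) * bg p q i.1 i.2.1 i.2.2) (idxWt i) := fun i => by
    have h0 := (isWeightedHomogeneous_of_mem hp hq (v i 0).2).mul (isWeightedHomogeneous_bf i)
    have h1 := (isWeightedHomogeneous_of_mem hp hq (v i 1).2).mul (isWeightedHomogeneous_bg i)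
    rw [zero_add] at h0 h1
    exact h0.add h1
  funext j
  have hj := congrArg (weightedHomogeneousComponent (wt p q) (idxWt j)) hv
  change weightedHomogeneousComponent (wt p q) (idxWt j) (∑ i, _) = _ at hj
  rw [map_zero, map_sum, Finset.sum_eq_single j, (hhom j).weightedHomogeneousComponent_same] at hj
  · obtain ⟨h0, h1⟩ := eq_zero_of_comb_pair hp hq _ _ j.2.2.2 (v j 0).2 (v j 1).2 hj
    ext i : 1
    fin_cases i
    · exact Subtype.ext h0
    · exact Subtype.ext h1
  · intro i _ hij
    exact (hhom i).weightedHomogeneousComponent_ne _ fun h => hij (idxWt_injective hq h.symm)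
  · simp

theorem comb_surjective (hp : 0 < p) (hq : 0 < q) : Function.Surjective (comb p q) := by
  rw [← LinearMap.range_eq_top]
  have hsingle : ∀ (i : Idx p q) (w : Fin 2 → R (p * q) p), comb p q (Pi.single i w) =
      (w 0 : MvPolynomial (Fin 2) ℂ) * bf q i.1 i.2.1 i.2.2 +
        (w 1 : MvPolynomial (Fin 2) ℂ) * bg p q i.1 i.2.1 i.2.2 := by
    intro i w
    change ∑ j, _ = _
    rw [Finset.sum_eq_single i]
    · simp
    · intro j _ hj; simp [hj]
    · simp
  refine span_basis hp hq _ (fun a b κ ha hb hκ => ?_) (fun a b κ ha hb hκ => ?_)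
  · exact ⟨Pi.single (⟨a, ha⟩, ⟨b, hb⟩, ⟨κ, hκ⟩) ![1, 0], by rw [hsingle]; simp⟩
  · exact ⟨Pi.single (⟨a, ha⟩, ⟨b, hb⟩, ⟨κ, hκ⟩) ![0, 1], by rw [hsingle]; simp⟩

end Basis

/-- If an endomorphism of a free module maps, for every `i`, the `i`-th pair of basis elements to
combinations of the `σ i`-th pair, then its cokernel is the sum of the cokernels of the blocks. -/
def cokEquivBlocks {B ι S Q : Type} [CommRing B] [Fintype ι] [DecidableEq ι] [AddCommGroup S]
    [Module B S] [AddCommGroup Q] [Module B Q] (Φ : (ι → Fin 2 → B) →ₗ[B] S)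
    (hΦ : Function.Injective Φ) (hΦ' : Function.Surjective Φ) (π : S →ₗ[B] Q)
    (hπ : Function.Surjective π) (Z : S → S) (hZ : ∀ x, π x = 0 ↔ ∃ y, x = Z y)
    (σ : Equiv.Perm ι) (M : ι → Matrix (Fin 2) (Fin 2) B)
    (hM : ∀ u, Z (Φ u) = Φ fun i => (M (σ.symm i)).mulVec (u (σ.symm i))) :
    Q ≃ₗ[B] ((i : ι) → Cok (M i)) :=
  -- Block i maps pair i to pair σ i; reindexing by `σ.symm` labels each target pair by its source,
  -- so that the kernel becomes the product of the ranges of the `M i`.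
  let P : (ι → Fin 2 → B) →ₗ[B] Q :=
    π.comp (Φ.comp (LinearEquiv.funCongrLeft B (Fin 2 → B) σ.symm).toLinearMap)
  have hP : Function.Surjective P := hπ.comp (hΦ'.comp (LinearEquiv.surjective _))
  have hker : LinearMap.ker P =
      Submodule.pi Set.univ (fun i => LinearMap.range (M i).mulVecLin) := by
    ext v
    have h : v ∈ LinearMap.ker P ↔ ∃ y, Φ (fun i => v (σ.symm i)) = Z y := hZ _
    rw [h, Submodule.mem_pi]
    constructor
    · rintro ⟨f, hf⟩ i -
      obtain ⟨u, rfl⟩ := hΦ' f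
      rw [hM] at hf
      have := congrFun (hΦ hf) (σ i)
      simp only [Equiv.symm_apply_apply] at this
      exact ⟨u i, this.symm⟩
    · intro hv
      choose u hu using fun i => hv i trivial
      refine ⟨Φ u, ?_⟩
      rw [hM]
      congr 1
      funext i
      exact (hu _).symm
  (P.quotKerEquivOfSurjective hP).symm.trans
    ((Submodule.quotEquivOfEq _ _ hker).trans (Submodule.quotientPi _))

section Quotient

variable {p n : ℕ}

/-- The block of multiplication by `z` on an isotypic component. -/
abbrev zBlock (p n : ℕ) (a b κ : ℕ) : Matrix (Fin 2) (Fin 2) (R (p * (n + 1)) p) :=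
  blockMat (sigma1 (p * (n + 1)) p) (sigma2 (p * (n + 1)) p) p (wr n a) (wr n b)
    (kk (nx n a) (nx n b) κ)

/-- Multiplication by `z` permutes the isotypic components. -/
def idxShift (p n : ℕ) : Equiv.Perm (Idx p (n + 1)) :=
  (finRotate (n + 1)).prodCongr ((finRotate (n + 1)).prodCongr (Equiv.refl _))

theorem z_mul_comb (hp : 0 < p) (u : Idx p (n + 1) → Fin 2 → R (p * (n + 1)) p) :
    z (p * (n + 1)) * comb p (n + 1) u = comb p (n + 1) (fun i =>
      (zBlock p n ((idxShift p n).symm i).1 ((idxShift p n).symm i).2.1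
        ((idxShift p n).symm i).2.2).mulVec (u ((idxShift p n).symm i))) := by
  change _ * ∑ i, _ = ∑ i, _
  -- The right-hand sum is reindexed by the source component i, whose image lies in the component
  -- `idxShift p n i`.
  rw [Finset.mul_sum, ← Equiv.sum_comp (idxShift p n) (fun i => (_ : MvPolynomial (Fin 2) ℂ) + _)]
  refine Finset.sum_congr rfl fun i _ => ?_
  beta_reduce
  have ha : (i.1 : ℕ) ≤ n := by omega
  have hb : (i.2.1 : ℕ) ≤ n := by omega
  have h1 := z_mul_bf ha hb i.2.2.2
  have h2 := z_mul_bg ha hb i.2.2.2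
  have hs := coe_sigma1 (q := n + 1) hp
  have ht : (sigma2 (p * (n + 1)) p : MvPolynomial (Fin 2) ℂ)
    = X 0 ^ (p * (n + 1)) + X 1 ^ (p * (n + 1)) := rfl
  have h2' : ((2 : R (p * (n + 1)) p) : MvPolynomial (Fin 2) ℂ) = 2 := rfl
  rw [Equiv.symm_apply_apply, show ((idxShift p n i).1 : ℕ) = nx n i.1 from coe_finRotate_eq _,
    show ((idxShift p n i).2.1 : ℕ) = nx n i.2.1 from coe_finRotate_eq _,
    show ((idxShift p n i).2.2) = i.2.2 from rfl]
  simp only [zBlock, blockMat, Matrix.mulVec, dotProduct, Fin.sum_univ_two, Matrix.of_apply,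
    Matrix.cons_val_zero, Matrix.cons_val_one, AddMemClass.coe_add, MulMemClass.coe_mul,
    SubmonoidClass.coe_pow, NegMemClass.coe_neg, hs, ht, h2']
  linear_combination (u i 0 : MvPolynomial (Fin 2) ℂ) * h1 + (u i 1 : MvPolynomial (Fin 2) ℂ) * h2

variable (hm : 0 < p * (n + 1)) (hpm : p ∣ p * (n + 1))

/-- The projection `S → S/(z)`, as an `R`-linear map. -/
def mkZ : MvPolynomial (Fin 2) ℂ →ₗ[R (p * (n + 1)) p] SModZ hm hpm where
  toFun f := Ideal.Quotient.mk (Ideal.span {z (p * (n + 1))}) f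
  map_add' _ _ := rfl
  map_smul' _ _ := rfl

end Quotient

/-! ### The types of the blocks -/

section BlockTypes

variable {B : Type} [CommRing B] (s t : B) {p : ℕ}

/-- The block for `k` is `K_k` if no coordinate wraps around. -/
def cokBlockK {k : ℕ} : Cok (blockMat s t p 0 0 k) ≃ₗ[B] Cok (matK s t p k) :=
  -- Only signs and the order of rows and columns change, here and for the other three block types.
  cokEquivOfInv _ _ !![0, -1; 1, 0] !![0, 1; 1, 0] !![0, 1; -1, 0] !![0, 1; 1, 0]
    (by ext a b; fin_cases a <;> fin_cases b <;> simp [blockMat, matK])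
    (by ext a b; fin_cases a <;> fin_cases b <;> simp)
    (by ext a b; fin_cases a <;> fin_cases b <;> simp)
    (by ext a b; fin_cases a <;> fin_cases b <;> simp)

/-- The block for `k` is `N_k` if both coordinates wrap around. -/
def cokBlockN {k : ℕ} (h : k ≤ p) : Cok (blockMat s t p 1 1 k) ≃ₗ[B] Cok (matN s t p k) :=
  cokEquivOfInv _ _ !![0, 1; 1, 0] !![0, -1; 1, 0] !![0, 1; 1, 0] !![0, 1; -1, 0]
    (by
      rw [blockMat, matN, show 1 + (p - k) = p + 1 - k by omega]
      ext a b; fin_cases a <;> fin_cases b <;> simp <;> ring)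
    (by ext a b; fin_cases a <;> fin_cases b <;> simp)
    (by ext a b; fin_cases a <;> fin_cases b <;> simp)
    (by ext a b; fin_cases a <;> fin_cases b <;> simp)

/-- The block for `k` is `X_{k+1}` if only the second coordinate wraps around. -/
def cokBlockX {k : ℕ} : Cok (blockMat s t p 0 1 k) ≃ₗ[B] Cok (matX s t p (k + 1)) :=
  cokEquivOfInv _ _ !![0, -1; 1, 0] !![0, 1; 1, 0] !![0, 1; -1, 0] !![0, 1; 1, 0]
    (by
      rw [blockMat, matX, show p + 1 - (k + 1) = p - k by omega]
      ext a b; fin_cases a <;> fin_cases b <;> simp <;> ring)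
    (by ext a b; fin_cases a <;> fin_cases b <;> simp)
    (by ext a b; fin_cases a <;> fin_cases b <;> simp)
    (by ext a b; fin_cases a <;> fin_cases b <;> simp)

/-- The block for `k` is `X_{p+1-k}` if only the first coordinate wraps around. -/
def cokBlockX' {k j : ℕ} (h : j + k = p + 1) (hk : k ≤ p) :
    Cok (blockMat s t p 1 0 k) ≃ₗ[B] Cok (matX s t p j) :=
  cokEquivOfInv _ _ !![1, 0; 0, -1] 1 !![1, 0; 0, -1] 1
    (by
      rw [blockMat, matX, show p + 1 - j = k by omega, show 1 + (p - k) = j by omega]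
      ext a b; fin_cases a <;> fin_cases b <;> simp [mul_comm])
    (by ext a b; fin_cases a <;> fin_cases b <;> simp)
    (by ext a b; fin_cases a <;> fin_cases b <;> simp)
    (by simp)

end BlockTypes

/-- Equal matrices have the same cokernel. -/
def cokCongr {B : Type} [CommRing B] {n : ℕ} {M M' : Matrix (Fin n) (Fin n) B} (h : M = M') :
    Cok M ≃ₗ[B] Cok M' :=
  Submodule.quotEquivOfEq _ _ (by rw [h])

theorem wr_castSucc {n : ℕ} (a : Fin n) : wr n a.castSucc = 0 := by
  simp [wr, a.2.ne]

theorem wr_last (n : ℕ) : wr n (Fin.last n) = 1 := by simp [wr]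

theorem nx_castSucc {n : ℕ} (a : Fin n) : nx n a.castSucc = a + 1 := by
  simp [nx, a.2.ne]

theorem nx_last (n : ℕ) : nx n (Fin.last n) = 0 := by simp [nx]

/-- Currying a product over triples. -/
def piTripleEquiv {B ι₁ ι₂ ι₃ : Type} [CommRing B] (F : ι₁ → ι₂ → ι₃ → Type)
    [∀ a b c, AddCommGroup (F a b c)] [∀ a b c, Module B (F a b c)] :
    ((i : ι₁ × ι₂ × ι₃) → F i.1 i.2.1 i.2.2) ≃ₗ[B] ((a : ι₁) → (b : ι₂) → (c : ι₃) → F a b c) where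
  toFun v a b c := v (a, b, c)
  invFun v i := v i.1 i.2.1 i.2.2
  map_add' _ _ := rfl
  map_smul' _ _ := rfl
  left_inv _ := rfl
  right_inv _ := rfl

/-! ### Assembling the blocks into the two decompositions -/

section Decomposition

variable {B : Type} [CommRing B] (s t : B) {p r n : ℕ}

/-- The blocks of multiplication by `z`. -/
abbrev blk (p n a b κ : ℕ) : Matrix (Fin 2) (Fin 2) B :=
  blockMat s t p (wr n a) (wr n b) (kk (nx n a) (nx n b) κ)

/-- Reversal of the order of a product over `Fin p`. -/
def piRev (F : ℕ → Type) [∀ i, AddCommGroup (F i)] [∀ i, Module B (F i)] :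
    ((i : Fin p) → F (Fin.rev i)) ≃ₗ[B] ((i : Fin p) → F i) :=
  LinearEquiv.piCongrLeft B (fun i : Fin p => F i) Fin.revPerm

/-- The blocks where no coordinate wraps around. -/
def blkK (a b : Fin n) : ((κ : Fin p) → Cok (blk s t p n a.castSucc b.castSucc κ)) ≃ₗ[B]
    ((κ : Fin p) → Cok (matK s t p κ)) :=
  if h : (a : ℕ) < b then
    -- For a < b the blocks are K_1, …, K_p; the reflection j ↦ p - j and a reversal of the order
    -- bring them to K_0, …, K_{p-1}.
    (LinearEquiv.piCongrRight fun κ : Fin p => (cokCongr (by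
      rw [blk, wr_castSucc, wr_castSucc, nx_castSucc, nx_castSucc, kk,
        if_pos (Nat.succ_lt_succ h)])).trans ((cokBlockK s t (k := κ + 1)).trans
          (cokKSymm s t (k := Fin.rev κ) (by rw [Fin.val_rev]; omega)))).trans
    (piRev fun i => Cok (matK s t p i))
  else
    LinearEquiv.piCongrRight fun κ : Fin p => (cokCongr (by
      rw [blk, wr_castSucc, wr_castSucc, nx_castSucc, nx_castSucc, kk,
        if_neg (fun h' => h (Nat.lt_of_succ_lt_succ h')), add_zero])).trans (cokBlockK s t (k := κ))

/-- The blocks where the second coordinate wraps around. -/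
def blkX (a : Fin n) : ((κ : Fin p) → Cok (blk s t p n a.castSucc (Fin.last n) κ)) ≃ₗ[B]
    ((κ : Fin p) → Cok (matX s t p (κ + 1))) :=
  -- The second coordinate has become 0, so no shift occurs in `kk`.
  LinearEquiv.piCongrRight fun κ : Fin p => (cokCongr (by
    rw [blk, wr_castSucc, wr_last, nx_castSucc, nx_last, kk, if_neg (Nat.not_lt_zero _),
      add_zero])).trans (cokBlockX s t (k := κ))

/-- The blocks where the first coordinate wraps around. -/
def blkX' (b : Fin n) : ((κ : Fin p) → Cok (blk s t p n (Fin.last n) b.castSucc κ)) ≃ₗ[B]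
    ((κ : Fin p) → Cok (matX s t p (κ + 1))) :=
  -- The first coordinate has become 0 and lies below the second, so `kk` is κ + 1 and the block is
  -- X_{p-κ}; reversal restores the order X_1, …, X_p.
  (LinearEquiv.piCongrRight fun κ : Fin p => (cokCongr (by
    rw [blk, wr_castSucc, wr_last, nx_castSucc, nx_last, kk, if_pos (Nat.succ_pos _)])).trans
      (cokBlockX' s t (k := κ + 1) (j := Fin.rev κ + 1) (by rw [Fin.val_rev]; omega)
        κ.2)).trans
    (piRev fun i => Cok (matX s t p (i + 1)))

/-- The blocks where both coordinates wrap around. -/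
def blkN : ((κ : Fin p) → Cok (blk s t p n (Fin.last n) (Fin.last n) κ)) ≃ₗ[B]
    ((κ : Fin p) → Cok (matN s t p κ)) :=
  LinearEquiv.piCongrRight fun κ : Fin p => (cokCongr (by
    rw [blk, wr_last, nx_last, kk, if_neg (Nat.not_lt_zero _), add_zero])).trans
      (cokBlockN s t κ.2.le)

/-- All blocks, with isomorphic summands collected. -/
def blocksEquiv (hp : p = (r + 1) + (r + 1)) :
    ((a b : Fin (n + 1)) → (κ : Fin p) → Cok (blk s t p n a b κ)) ≃ₗ[B]
      ((j : Finset.Icc 1 p) → Fin (2 * n) → Cok (matX s t p j)) ×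
      ((j : Finset.Icc 1 r) → Fin 2 → Cok (matN s t p j)) ×
      ((j : Finset.Icc 1 r) → Fin (2 * n ^ 2) → Cok (matK s t p j)) ×
      (Fin n × Fin n → Cok (matK s t p (r + 1))) ×
      (Fin n × Fin n → Cok (matK s t p 0)) ×
      Cok (matN s t p 0) × Cok (matN s t p (r + 1)) :=
  collect s t hp (fun a b => (κ : Fin p) → Cok (blk s t p n a b κ))
    (blkK s t) (blkX s t) (blkX' s t) (blkN s t)

theorem isScalarTower_of_mk_smul {I : Ideal B} {Q : Type} [AddCommGroup Q] [Module B Q]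
    [Module (B ⧸ I) Q] (h : ∀ (b : B) (x : Q), Ideal.Quotient.mk I b • x = b • x) :
    IsScalarTower B (B ⧸ I) Q where
  smul_assoc a x m := by
    obtain ⟨b, rfl⟩ := Ideal.Quotient.mk_surjective x
    rw [h, ← mul_smul, ← h]
    rfl

instance {f : B} {k : ℕ} (M : MatFact f k) : IsScalarTower B (B ⧸ Ideal.span {f}) M.Coker :=
  isScalarTower_of_mk_smul M.mk_smul

/-- The cokernel of a matrix factorization is the cokernel of its first matrix. -/
def MatFact.cokEquiv {f : B} {k : ℕ} (M : MatFact f k) : Cok M.φ ≃ₗ[B] M.Coker :=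
  LinearEquiv.refl B (Cok M.φ)

/-- Splitting the power `M ^ (n ^ 2)`. -/
def squareEquiv (M : Type) [AddCommGroup M] [Module B M] :
    (Fin n × Fin n → M) ≃ₗ[B] (Fin (2 * n.choose 2) → M) × (Fin n → M) :=
  (arrowCardEquiv M (a := n * n) (by simp)).trans
    (arrowProdEquiv M (by simp [← card_pairs n, add_comm])).symm

/-- The cokernel of a `1 × 1` matrix factorization. -/
def cokOfMul {f : B} (a b : B) (h : a * b = f) : Cok !![a] ≃ₗ[B] (MatFact.ofMul a b h).Coker :=
  (MatFact.ofMul a b h).cokEquiv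

section Shuffle

variable (B)
variable (X N K L M A U C C' D D' V : Type) [AddCommGroup X] [Module B X] [AddCommGroup N]
  [Module B N] [AddCommGroup K] [Module B K] [AddCommGroup L] [Module B L] [AddCommGroup M]
  [Module B M] [AddCommGroup A] [Module B A] [AddCommGroup U] [Module B U] [AddCommGroup C]
  [Module B C] [AddCommGroup C'] [Module B C'] [AddCommGroup D] [Module B D] [AddCommGroup D']
  [Module B D'] [AddCommGroup V] [Module B V]

/-- A permutation of direct summands. -/
def shuffleOne (n : ℕ) :
    (X × N × K × (L × (Fin n → D × D')) × (M × (Fin n → U)) × (A × V) × (C × C')) ≃ₗ[B]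
      X × N × K × L × M × A × (Fin n → U) × C × (Fin n → D) × C' × (Fin n → D') × V where
  toFun := fun ⟨x, y, k, ⟨l, d⟩, ⟨m, u⟩, ⟨a, v⟩, ⟨c, c'⟩⟩ =>
    ⟨x, y, k, l, m, a, u, c, fun i => (d i).1, c', fun i => (d i).2, v⟩
  invFun := fun ⟨x, y, k, l, m, a, u, c, d, c', d', v⟩ =>
    ⟨x, y, k, ⟨l, fun i => (d i, d' i)⟩, ⟨m, u⟩, ⟨a, v⟩, ⟨c, c'⟩⟩
  map_add' _ _ := rfl
  map_smul' _ _ := rfl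
  left_inv _ := rfl
  right_inv _ := rfl

/-- A permutation of direct summands. -/
def shuffleTwo (n : ℕ) :
    (X × N × K × (Fin n → D × D') × (Fin n → U) × (A × V) × (C × C')) ≃ₗ[B]
      X × N × K × A × (Fin n → U) × C × (Fin n → D) × C' × (Fin n → D') × V where
  toFun := fun ⟨x, y, k, d, u, ⟨a, v⟩, ⟨c, c'⟩⟩ =>
    ⟨x, y, k, a, u, c, fun i => (d i).1, c', fun i => (d i).2, v⟩
  invFun := fun ⟨x, y, k, a, u, c, d, c', d', v⟩ =>
    ⟨x, y, k, fun i => (d i, d' i), u, ⟨a, v⟩, ⟨c, c'⟩⟩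
  map_add' _ _ := rfl
  map_smul' _ _ := rfl
  left_inv _ := rfl
  right_inv _ := rfl

end Shuffle

/-- The decomposition into indecomposable and redundant summands, before `K_0` and `K_{p/2}` are
decomposed. -/
def decompositionEquiv {c : B} (hc : 2 * c = 1) (hp : Even p) (hp' : 0 < p) :
    ((i : Idx p (n + 1)) → Cok (blk s t p n i.1 i.2.1 i.2.2)) ≃ₗ[B]
      ((j : Finset.Icc 1 p) → Fin (2 * n) → XMod s t (p := p) j (le_of_mem_Icc j)) ×
      ((j : Finset.Icc 1 ((p - 2) / 2)) → Fin 2 → NMod s t (p := p) j (le_of_mem_Icc_half j)) ×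
      ((j : Finset.Icc 1 ((p - 2) / 2)) → Fin (2 * n ^ 2) →
        KMod s t (p := p) j (le_of_mem_Icc_half j)) ×
      (Fin n × Fin n → Cok (matK s t p (p / 2))) × (Fin n × Fin n → Cok (matK s t p 0)) ×
      (AMod s t p × (B ⧸ Ideal.span {disc s t p})) × CPlus s t hp × CMinus s t hp :=
  have hr : p = ((p - 2) / 2 + 1) + ((p - 2) / 2 + 1) := by obtain ⟨k, rfl⟩ := hp; omega
  have hh : (p - 2) / 2 + 1 = p / 2 := by omega
  have hh2 : p = p / 2 + p / 2 := by omega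
  let eX : ((j : Finset.Icc 1 p) → Fin (2 * n) → Cok (matX s t p j)) ≃ₗ[B]
      ((j : Finset.Icc 1 p) → Fin (2 * n) → XMod s t (p := p) j (le_of_mem_Icc j)) :=
    LinearEquiv.piCongrRight fun j => LinearEquiv.piCongrRight fun _ =>
      (xiEta s t j (le_of_mem_Icc j)).cokEquiv
  let eN : ((j : Finset.Icc 1 ((p - 2) / 2)) → Fin 2 → Cok (matN s t p j)) ≃ₗ[B]
      ((j : Finset.Icc 1 ((p - 2) / 2)) → Fin 2 → NMod s t (p := p) j (le_of_mem_Icc_half j)) :=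
    LinearEquiv.piCongrRight fun j => LinearEquiv.piCongrRight fun _ =>
      (psiPhi s t j (le_of_mem_Icc_half j)).cokEquiv
  let eK : ((j : Finset.Icc 1 ((p - 2) / 2)) → Fin (2 * n ^ 2) → Cok (matK s t p j)) ≃ₗ[B]
      ((j : Finset.Icc 1 ((p - 2) / 2)) → Fin (2 * n ^ 2) →
        KMod s t (p := p) j (le_of_mem_Icc_half j)) :=
    LinearEquiv.piCongrRight fun j => LinearEquiv.piCongrRight fun _ =>
      (phiPsi s t j (le_of_mem_Icc_half j)).cokEquiv
  let eA : Cok (matN s t p 0) ≃ₗ[B] AMod s t p × (B ⧸ Ideal.span {disc s t p}) :=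
    (cokNZero s t hc).trans ((cokOfMul _ _ _).prodCongr (cokSingletonEquiv _).symm)
  let eC : Cok (matN s t p ((p - 2) / 2 + 1)) ≃ₗ[B] CPlus s t hp × CMinus s t hp :=
    (cokCongr (by rw [hh])).trans
      ((cokNHalf s t hc hh2).trans ((cokOfMul _ _ _).prodCongr (cokOfMul _ _ _)))
  let eH : (Fin n × Fin n → Cok (matK s t p ((p - 2) / 2 + 1))) ≃ₗ[B]
      (Fin n × Fin n → Cok (matK s t p (p / 2))) :=
    LinearEquiv.piCongrRight fun _ => cokCongr (by rw [hh])
  (piTripleEquiv fun (a b : Fin (n + 1)) (κ : Fin p) => Cok (blk s t p n a b κ)).trans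
    <| (blocksEquiv s t hr).trans (eX.prodCongr (eN.prodCongr (eK.prodCongr (eH.prodCongr
    ((LinearEquiv.refl B _).prodCongr (eA.prodCongr eC))))))

/-- `K_0 ≅ B`. -/
def kZeroEquiv {c : B} (hc : 2 * c = 1) : Cok (matK s t p 0) ≃ₗ[B] BMod s t p :=
  (cokKZero s t hc).trans (cokOfMul _ _ _)

/-- `K_{p/2} ≅ D₊ ⊕ D₋`. -/
def kHalfEquiv {c : B} (hc : 2 * c = 1) (hp : Even p) :
    Cok (matK s t p (p / 2)) ≃ₗ[B] DPlus s t hp × DMinus s t hp :=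
  (cokKHalf s t hc (by obtain ⟨k, rfl⟩ := hp; omega)).trans
    ((cokOfMul _ _ _).prodCongr (cokOfMul _ _ _))

variable {Q : Type} [AddCommGroup Q] [Module B Q] [Module (B ⧸ Ideal.span {disc s t p}) Q]

/-- Of the n² copies each of K_0 and K_{p/2}, n are rewritten as B and as D₊ ⊕ D₋, and 2·C(n,2) are
kept. -/
theorem decomposition_one {c : B} (hc : 2 * c = 1) (hp : Even p) (hp' : 0 < p)
    (hQ : ∀ (b : B) (x : Q), Ideal.Quotient.mk (Ideal.span {disc s t p}) b • x = b • x)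
    (e : Q ≃ₗ[B] ((i : Idx p (n + 1)) → Cok (blk s t p n i.1 i.2.1 i.2.2))) :
    Nonempty (Q ≃ₗ[B ⧸ Ideal.span {disc s t p}]
      ((j : Finset.Icc 1 p) → Fin (2 * n) → XMod s t (p := p) j (le_of_mem_Icc j)) ×
      ((j : Finset.Icc 1 ((p - 2) / 2)) → Fin 2 → NMod s t (p := p) j (le_of_mem_Icc_half j)) ×
      ((j : Finset.Icc 1 ((p - 2) / 2)) → Fin (2 * n ^ 2) →
        KMod s t (p := p) j (le_of_mem_Icc_half j)) ×
      (Fin (2 * n.choose 2) → KMod s t (p := p) (p / 2) (Nat.div_le_self p 2)) ×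
      (Fin (2 * n.choose 2) → KMod s t (p := p) 0 (Nat.zero_le p)) ×
      AMod s t p × (Fin n → BMod s t p) × CPlus s t hp × (Fin n → DPlus s t hp) ×
      CMinus s t hp × (Fin n → DMinus s t hp) × (B ⧸ Ideal.span {disc s t p})) := by
  have : IsScalarTower B (B ⧸ Ideal.span {disc s t p}) Q := isScalarTower_of_mk_smul hQ
  let eH : (Fin n × Fin n → Cok (matK s t p (p / 2))) ≃ₗ[B]
      (Fin (2 * n.choose 2) → KMod s t (p := p) (p / 2) (Nat.div_le_self p 2)) ×
      (Fin n → DPlus s t hp × DMinus s t hp) :=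
    (squareEquiv _).trans ((LinearEquiv.piCongrRight fun _ => MatFact.cokEquiv
      (phiPsi s t (p / 2) (Nat.div_le_self p 2))).prodCongr
      (LinearEquiv.piCongrRight fun _ => kHalfEquiv s t hc hp))
  let eZ : (Fin n × Fin n → Cok (matK s t p 0)) ≃ₗ[B]
      (Fin (2 * n.choose 2) → KMod s t (p := p) 0 (Nat.zero_le p)) × (Fin n → BMod s t p) :=
    (squareEquiv _).trans ((LinearEquiv.piCongrRight fun _ => MatFact.cokEquiv
      (phiPsi s t 0 (Nat.zero_le p))).prodCongr
      (LinearEquiv.piCongrRight fun _ => kZeroEquiv s t hc))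
  let e' := ((e.trans (decompositionEquiv s t hc hp hp')).trans
    ((LinearEquiv.refl B _).prodCongr ((LinearEquiv.refl B _).prodCongr
      ((LinearEquiv.refl B _).prodCongr (eH.prodCongr (eZ.prodCongr (LinearEquiv.refl B _))))))).trans
    (shuffleOne B _ _ _ _ _ _ _ _ _ _ _ _ n)
  -- All scalar actions of the quotient ring are induced from `B`, so a `B`-linear equivalence is
  -- automatically linear over the quotient.
  exact ⟨e'.extendScalarsOfSurjective Ideal.Quotient.mk_surjective⟩

/-- Here all n² = n + 2·C(n,2) copies of K_0 and K_{p/2} are rewritten. -/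
theorem decomposition_two {c : B} (hc : 2 * c = 1) (hp : Even p) (hp' : 0 < p)
    (hQ : ∀ (b : B) (x : Q), Ideal.Quotient.mk (Ideal.span {disc s t p}) b • x = b • x)
    (e : Q ≃ₗ[B] ((i : Idx p (n + 1)) → Cok (blk s t p n i.1 i.2.1 i.2.2))) :
    Nonempty (Q ≃ₗ[B ⧸ Ideal.span {disc s t p}]
      ((j : Finset.Icc 1 p) → Fin (2 * n) → XMod s t (p := p) j (le_of_mem_Icc j)) ×
      ((j : Finset.Icc 1 ((p - 2) / 2)) → Fin 2 → NMod s t (p := p) j (le_of_mem_Icc_half j)) ×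
      ((j : Finset.Icc 1 ((p - 2) / 2)) → Fin (2 * n ^ 2) →
        KMod s t (p := p) j (le_of_mem_Icc_half j)) ×
      AMod s t p × (Fin (n + 2 * n.choose 2) → BMod s t p) ×
      CPlus s t hp × (Fin (n + 2 * n.choose 2) → DPlus s t hp) ×
      CMinus s t hp × (Fin (n + 2 * n.choose 2) → DMinus s t hp) ×
      (B ⧸ Ideal.span {disc s t p})) := by
  have : IsScalarTower B (B ⧸ Ideal.span {disc s t p}) Q := isScalarTower_of_mk_smul hQ
  have hcard : Fintype.card (Fin n × Fin n) = n + 2 * n.choose 2 := by simp [card_pairs]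
  let eH : (Fin n × Fin n → Cok (matK s t p (p / 2))) ≃ₗ[B]
      (Fin (n + 2 * n.choose 2) → DPlus s t hp × DMinus s t hp) :=
    (LinearEquiv.piCongrRight fun _ => kHalfEquiv s t hc hp).trans (arrowCardEquiv _ hcard)
  let eZ : (Fin n × Fin n → Cok (matK s t p 0)) ≃ₗ[B] (Fin (n + 2 * n.choose 2) → BMod s t p) :=
    (LinearEquiv.piCongrRight fun _ => kZeroEquiv s t hc).trans (arrowCardEquiv _ hcard)
  let e' := ((e.trans (decompositionEquiv s t hc hp hp')).trans
    ((LinearEquiv.refl B _).prodCongr ((LinearEquiv.refl B _).prodCongr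
      ((LinearEquiv.refl B _).prodCongr (eH.prodCongr (eZ.prodCongr (LinearEquiv.refl B _))))))).trans
    (shuffleTwo B _ _ _ _ _ _ _ _ _ _ (n + 2 * n.choose 2))
  exact ⟨e'.extendScalarsOfSurjective Ideal.Quotient.mk_surjective⟩

end Decomposition

/-! ### Basic invariants -/

section BasicInvariants

variable {p q : ℕ} (hp : 0 < p) (hq : 0 < q)
include hp hq

/-- The orbit map `(x, y) ↦ (σ₁, σ₂)` is surjective. -/
theorem exists_point (s₀ t₀ : ℂ) : ∃ x y : ℂ, (x * y) ^ q = s₀ ∧ x ^ (p * q) + y ^ (p * q) = t₀ := by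
  have hm : 0 < p * q := Nat.mul_pos hp hq
  obtain ⟨w, hw⟩ := IsAlgClosed.exists_pow_nat_eq s₀ hq
  obtain ⟨d, hd⟩ := IsAlgClosed.exists_pow_nat_eq (t₀ ^ 2 - 4 * w ^ (p * q)) two_pos
  -- With xy = w, the values x^m and y^m must be the roots of T² - t₀T + w^m; these are (t₀ ± d)/2.
  -- If the root meant for x^m vanishes, then w = 0 and x = 0 works.
  have huv : (t₀ + d) / 2 * ((t₀ - d) / 2) = w ^ (p * q) := by linear_combination -hd / 4
  rcases eq_or_ne ((t₀ + d) / 2) 0 with hu | hu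
  · obtain ⟨y, hy⟩ := IsAlgClosed.exists_pow_nat_eq t₀ hm
    refine ⟨0, y, ?_, by rw [zero_pow hm.ne', hy, zero_add]⟩
    rw [hu, zero_mul] at huv
    have hw0 : w = 0 := by
      by_contra h
      exact pow_ne_zero _ h huv.symm
    rw [← hw, hw0, zero_mul]
  · obtain ⟨x, hx⟩ := IsAlgClosed.exists_pow_nat_eq ((t₀ + d) / 2) hm
    have hx0 : x ≠ 0 := by
      rintro rfl
      rw [zero_pow hm.ne'] at hx
      exact hu hx.symm
    refine ⟨x, w / x, by rw [mul_div_cancel₀ _ hx0, hw], ?_⟩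
    rw [div_pow, hx, ← huv, mul_div_cancel_left₀ _ hu]
    ring

/-- By `exists_point`, a polynomial relation between σ₁ and σ₂ vanishes at every point of ℂ², hence
is zero. -/
theorem algebraicIndependent_sigma :
    AlgebraicIndependent ℂ ![sigma1 (p * q) p, sigma2 (p * q) p] := by
  rw [algebraicIndependent_iff]
  intro P hP
  refine MvPolynomial.funext fun v => ?_
  obtain ⟨x, y, h1, h2⟩ := exists_point hp hq (v 0) (v 1)
  let ev : R (p * q) p →ₐ[ℂ] ℂ := (aeval ![x, y]).comp (R (p * q) p).val
  have h : aeval (fun i => ev (![sigma1 (p * q) p, sigma2 (p * q) p] i)) P = 0 := by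
    rw [← comp_aeval_apply _ ev, hP, map_zero]
  have hv : (fun i => ev (![sigma1 (p * q) p, sigma2 (p * q) p] i)) = v := by
    funext i
    fin_cases i
    · change aeval ![x, y] (sigma1 (p * q) p : MvPolynomial (Fin 2) ℂ) = v 0
      rw [coe_sigma1 hp, ← h1]; simp
    · change aeval ![x, y] (X 0 ^ (p * q) + X 1 ^ (p * q) : MvPolynomial (Fin 2) ℂ) = v 1
      rw [← h2]; simp
  rw [hv] at h
  rw [map_zero]
  exact h

omit hp hq in
-- Newton's recurrence for x^m and y^m, whose sum is σ₂ and whose product is σ₁^p.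
theorem powerSum_mem {A : Subalgebra ℂ (MvPolynomial (Fin 2) ℂ)} (hs : (X 0 * X 1) ^ q ∈ A)
    (ht : X 0 ^ (p * q) + X 1 ^ (p * q) ∈ A) (k : ℕ) :
    X 0 ^ (p * q * k) + X 1 ^ (p * q * k) ∈ A := by
  induction k using Nat.twoStepInduction with
  | zero =>
    rw [mul_zero, pow_zero, pow_zero]
    exact A.add_mem A.one_mem A.one_mem
  | one => rwa [mul_one]
  | more k h h' =>
    have := A.sub_mem (A.mul_mem ht h') (A.mul_mem (A.pow_mem hs p) h)
    convert this using 1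
    ring

omit hp hq in
theorem symmetrized_monomial_mem {A : Subalgebra ℂ (MvPolynomial (Fin 2) ℂ)}
    (hs : (X 0 * X 1) ^ q ∈ A) (ht : X 0 ^ (p * q) + X 1 ^ (p * q) ∈ A) (b k : ℕ) :
    X 0 ^ (q * b + p * q * k) * X 1 ^ (q * b) + X 0 ^ (q * b) * X 1 ^ (q * b + p * q * k) ∈ A := by
  have := A.mul_mem (A.pow_mem hs b) (powerSum_mem hs ht k)
  convert this using 1
  ring

/-- Since f is fixed by the swap, 2f is a sum of symmetrized monomials from the support of f; the
exponent conditions there make each of them a power of σ₁ times a power sum. -/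
theorem mem_of_invariant {A : Subalgebra ℂ (MvPolynomial (Fin 2) ℂ)}
    (hs : (X 0 * X 1) ^ q ∈ A) (ht : X 0 ^ (p * q) + X 1 ^ (p * q) ∈ A)
    {f : MvPolynomial (Fin 2) ℂ} (hf : f ∈ R (p * q) p) : f ∈ A := by
  have h2 : f + f ∈ A := by
    nth_rewrite 2 [← rename_swap_of_mem hf]
    rw [← support_sum_monomial_coeff f, map_sum, ← Finset.sum_add_distrib]
    refine A.sum_mem fun d hd => ?_
    obtain ⟨⟨b, hb⟩, hd'⟩ := dvd_of_coeff_ne_zero hp hq hf (mem_support_iff.mp hd)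
    have e : monomial d (coeff d f) + rename (Equiv.swap (0 : Fin 2) 1) (monomial d (coeff d f))
        = C (coeff d f) * (X 0 ^ d 0 * X 1 ^ d 1 + X 0 ^ d 1 * X 1 ^ d 0) := by
      rw [monomial_fin_two, map_mul, rename_C, map_mul, map_pow, map_pow, rename_X, rename_X,
        Equiv.swap_apply_left, Equiv.swap_apply_right]
      ring
    rw [e]
    refine A.mul_mem (A.algebraMap_mem _) ?_
    rcases le_total (d 1) (d 0) with h | h
    · obtain ⟨k, hk⟩ : p * q ∣ d 0 - d 1 := by
        rw [← Int.natCast_dvd_natCast, Nat.cast_sub h]; exact hd'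
      rw [show d 0 = q * b + p * q * k by omega, hb]
      exact symmetrized_monomial_mem hs ht b k
    · obtain ⟨k, hk⟩ : p * q ∣ d 1 - d 0 := by
        rw [← Int.natCast_dvd_natCast, Nat.cast_sub h, ← dvd_neg, neg_sub]; exact hd'
      -- Now `d 0` is the smaller exponent; its divisibility by q comes from that of `d 1` and of
      -- the difference.
      have hb' : d 0 = q * (b - p * k) := by
        rw [Nat.mul_sub, ← hb]
        have : q * (p * k) = p * q * k := by ring
        omega
      rw [show d 1 = q * (b - p * k) + p * q * k by omega, hb', add_comm]
      exact symmetrized_monomial_mem hs ht _ k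
  have := A.smul_mem h2 (1 / 2 : ℂ)
  rwa [← two_smul ℂ f, smul_smul, one_div, inv_mul_cancel₀ two_ne_zero, one_smul] at this

theorem adjoin_sigma :
    Algebra.adjoin ℂ {sigma1 (p * q) p, sigma2 (p * q) p} = (⊤ : Subalgebra ℂ (R (p * q) p)) := by
  rw [eq_top_iff]
  rintro f -
  set A := Algebra.adjoin ℂ {sigma1 (p * q) p, sigma2 (p * q) p}
  have hs : (sigma1 (p * q) p : MvPolynomial (Fin 2) ℂ) ∈ A.map (R (p * q) p).val :=
    ⟨sigma1 (p * q) p, Algebra.subset_adjoin (by simp), rfl⟩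
  have ht : (sigma2 (p * q) p : MvPolynomial (Fin 2) ℂ) ∈ A.map (R (p * q) p).val :=
    ⟨sigma2 (p * q) p, Algebra.subset_adjoin (by simp), rfl⟩
  rw [coe_sigma1 hp] at hs
  obtain ⟨g, hg, hgf⟩ := mem_of_invariant hp hq hs ht f.2
  rwa [← Subtype.ext hgf]

end BasicInvariants

/-! ### The reflecting hyperplanes -/

section Hyperplanes

theorem mem_fixedSpace {n : ℕ} {g : Matrix.GeneralLinearGroup (Fin n) ℂ} {v : Fin n → ℂ} :
    v ∈ fixedSpace g ↔ (g : Matrix (Fin n) (Fin n) ℂ).mulVec v = v := by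
  rw [fixedSpace, LinearMap.mem_ker, LinearMap.sub_apply, sub_eq_zero]
  rfl

theorem mem_fixedSpace_diag {g : Matrix.GeneralLinearGroup (Fin 2) ℂ} {a b : ℂ}
    (hg : (g : Matrix (Fin 2) (Fin 2) ℂ) = !![a, 0; 0, b]) {v : Fin 2 → ℂ} :
    v ∈ fixedSpace g ↔ a * v 0 = v 0 ∧ b * v 1 = v 1 := by
  rw [mem_fixedSpace, hg, funext_iff, Fin.forall_fin_two]
  simp [Matrix.mulVec, dotProduct, Fin.sum_univ_two]

theorem mem_fixedSpace_antidiag {g : Matrix.GeneralLinearGroup (Fin 2) ℂ} {a b : ℂ}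
    (hg : (g : Matrix (Fin 2) (Fin 2) ℂ) = !![0, a; b, 0]) {v : Fin 2 → ℂ} :
    v ∈ fixedSpace g ↔ a * v 1 = v 0 ∧ b * v 0 = v 1 := by
  rw [mem_fixedSpace, hg, funext_iff, Fin.forall_fin_two]
  simp [Matrix.mulVec, dotProduct, Fin.sum_univ_two]

theorem Gmpn_cases {m p : ℕ} {g : Matrix.GeneralLinearGroup (Fin 2) ℂ} (hg : g ∈ Gmpn m p 2) :
    ∃ a b : ℂˣ, a ^ m = 1 ∧ b ^ m = 1 ∧ (a * b) ^ (m / p) = 1 ∧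
      ((g : Matrix (Fin 2) (Fin 2) ℂ) = !![(a : ℂ), 0; 0, (b : ℂ)] ∨
        (g : Matrix (Fin 2) (Fin 2) ℂ) = !![0, (a : ℂ); (b : ℂ), 0]) := by
  obtain ⟨w, d, hd, hd', hg⟩ := hg
  rw [Fin.prod_univ_two] at hd'
  obtain hw | hw := (by decide : ∀ w : Equiv.Perm (Fin 2),
      (w 0 = 0 ∧ w 1 = 1) ∨ (w 0 = 1 ∧ w 1 = 0)) w
  · refine ⟨d 0, d 1, hd _, hd _, hd', Or.inl ?_⟩
    rw [hg]
    ext i j; rw [perm_mul_diagonal_apply]; fin_cases i <;> fin_cases j <;> simp [hw]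
  · refine ⟨d 1, d 0, hd _, hd _, by rwa [mul_comm], Or.inr ?_⟩
    rw [hg]
    ext i j; rw [perm_mul_diagonal_apply]; fin_cases i <;> fin_cases j <;> simp [hw]

/-- The line `{c.1 x + c.2 y = 0}` in the plane. -/
def line (c : ℂ × ℂ) : Submodule ℂ (Fin 2 → ℂ) :=
  LinearMap.ker (c.1 • LinearMap.proj (0 : Fin 2) + c.2 • LinearMap.proj (1 : Fin 2) :
    (Fin 2 → ℂ) →ₗ[ℂ] ℂ)

theorem mem_line {c : ℂ × ℂ} {v : Fin 2 → ℂ} : v ∈ line c ↔ c.1 * v 0 + c.2 * v 1 = 0 := by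
  rw [line, LinearMap.mem_ker]; rfl

theorem finrank_line {c : ℂ × ℂ} (hc : c ≠ 0) : Module.finrank ℂ (line c) = 1 := by
  have hne : (![-c.2, c.1] : Fin 2 → ℂ) ≠ 0 := fun h => hc (Prod.ext
    (by simpa using congrFun h 1) (by simpa using congrFun h 0))
  have : line c = Submodule.span ℂ {![-c.2, c.1]} := by
    ext v
    rw [mem_line, Submodule.mem_span_singleton]
    constructor
    · intro h
      rcases eq_or_ne c.1 0 with h1 | h1
      · have h2 : c.2 ≠ 0 := fun h2 => hc (Prod.ext h1 h2)
        have hv : v 1 = 0 := by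
          rw [h1, zero_mul, zero_add] at h
          exact (mul_eq_zero.mp h).resolve_left h2
        refine ⟨-v 0 / c.2, ?_⟩
        ext i; fin_cases i <;> simp [h1, hv]
        field_simp
      · refine ⟨v 1 / c.1, ?_⟩
        ext i; fin_cases i <;> simp
        · field_simp; linear_combination -h
        · field_simp
    · rintro ⟨a, rfl⟩
      simp; ring
  rw [this, finrank_span_singleton hne]

/-- The linear form `c.1 x + c.2 y`. -/
def linForm (c : ℂ × ℂ) : MvPolynomial (Fin 2) ℂ := C c.1 * X 0 + C c.2 * X 1

theorem isDefiningForm_linForm (c : ℂ × ℂ) : IsDefiningForm (line c) (linForm c) :=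
  ⟨(isHomogeneous_C_mul_X _ _).add (isHomogeneous_C_mul_X _ _), fun v => by
    rw [mem_line]; simp [linForm]⟩

/-- Index set of the reflecting lines of `G(m,p,2)`. -/
abbrev LineIdx (m : ℕ) : Type := Fin 2 ⊕ Polynomial.nthRootsFinset m (1 : ℂ)

/-- The coefficients of the linear forms defining the reflecting lines of `G(m,p,2)`. -/
def lineCoeff {m : ℕ} : LineIdx m → ℂ × ℂ :=
  Sum.elim ![(1, 0), (0, 1)] fun ζ => (1, -(ζ : ℂ))

theorem lineCoeff_ne_zero {m : ℕ} (i : LineIdx m) : lineCoeff i ≠ 0 := by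
  rcases i with i | ζ
  · fin_cases i <;> simp [lineCoeff]
  · simp [lineCoeff]

/-- The direction vector of one line lies on the other only if the coefficient pairs are
proportional, and the chosen pairs are normalized with first nonzero entry 1. -/
theorem line_injective {m : ℕ} (hm : 0 < m) :
    Function.Injective fun i : LineIdx m => line (lineCoeff i) := by
  intro i j h
  have hmem : (![-(lineCoeff i).2, (lineCoeff i).1] : Fin 2 → ℂ) ∈ line (lineCoeff j) := by
    rw [← show line (lineCoeff i) = line (lineCoeff j) from h, mem_line]
    simp; ring
  rw [mem_line] at hmem
  have hne : ∀ ζ : Polynomial.nthRootsFinset m (1 : ℂ), (ζ : ℂ) ≠ 0 := fun ζ h0 => by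
    have := (Polynomial.mem_nthRootsFinset hm (1 : ℂ)).mp ζ.2
    rw [h0, zero_pow hm.ne'] at this
    exact zero_ne_one this
  rcases i with i | ζ <;> rcases j with j | ξ
  · fin_cases i <;> fin_cases j <;> simp [lineCoeff] at hmem ⊢
  · fin_cases i <;> simp [lineCoeff, hne] at hmem
  · fin_cases j <;> simp [lineCoeff, hne] at hmem
  · simp only [lineCoeff, Sum.elim_inr, Matrix.cons_val_zero, Matrix.cons_val_one] at hmem
    exact congrArg Sum.inr (Subtype.ext (by linear_combination hmem))

variable {p q : ℕ} (hp : 0 < p) (hq : 1 < q)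
include hp hq

omit hp in
-- Supplies the reflections diag(ω, 1) and diag(1, ω) that make the coordinate axes reflecting
-- lines; this is where q > 1, that is m ≠ p, matters.
theorem exists_root_ne_one : ∃ ω : ℂˣ, (ω : ℂ) ≠ 1 ∧ ω ^ q = 1 ∧ ω ^ (p * q) = 1 := by
  obtain ⟨ω, hω⟩ := exists_unit_primitiveRoot (n := q) (by omega)
  have h : ω ^ q = 1 := Units.ext (by simpa using hω.pow_eq_one)
  exact ⟨ω, hω.ne_one hq, h, by rw [mul_comm, pow_mul, h, one_pow]⟩

omit hp hq in
theorem unit_of_mem_nthRootsFinset {m : ℕ} (hm : 0 < m)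
    (ζ : Polynomial.nthRootsFinset m (1 : ℂ)) : ∃ u : ℂˣ, (u : ℂ) = ζ ∧ u ^ m = 1 := by
  have h := (Polynomial.mem_nthRootsFinset hm (1 : ℂ)).mp ζ.2
  have h0 : (ζ : ℂ) ≠ 0 := fun h0 => by
    rw [h0, zero_pow hm.ne'] at h
    exact zero_ne_one h
  exact ⟨Units.mk0 _ h0, rfl, Units.ext (by simpa using h)⟩

/-- The fixed space of diag(a, b) is a line exactly when one of a, b is 1 and the other is not. An
antidiagonal matrix with entries a, b squares to the scalar ab, so it fixes a nonzero vector only if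
ab = 1, and then its fixed line is x = a y. -/
theorem hyperplanes_eq :
    hyperplanes (Gmpn (p * q) p 2) = Set.range fun i : LineIdx (p * q) => line (lineCoeff i) := by
  have hm : 0 < p * q := Nat.mul_pos hp (by omega)
  have hdiv : p * q / p = q := Nat.mul_div_cancel_left _ hp
  ext W
  constructor
  · rintro ⟨hW, g, hg, rfl⟩
    obtain ⟨a, b, ha, hb, -, h | h⟩ := Gmpn_cases hg
    · rcases eq_or_ne (a : ℂ) 1 with ha1 | ha1 <;> rcases eq_or_ne (b : ℂ) 1 with hb1 | hb1
      · have : fixedSpace g = ⊤ := by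
          ext v; rw [mem_fixedSpace_diag h, ha1, hb1]; simp
        rw [this, finrank_top, Module.finrank_fin_fun] at hW
        omega
      · refine ⟨Sum.inl 1, ?_⟩
        ext v
        rw [mem_fixedSpace_diag h, mem_line, ha1]
        simp [lineCoeff, mul_left_eq_self₀, hb1]
      · refine ⟨Sum.inl 0, ?_⟩
        ext v
        rw [mem_fixedSpace_diag h, mem_line, hb1]
        simp [lineCoeff, mul_left_eq_self₀, ha1]
      · have : fixedSpace g = ⊥ := by
          ext v
          rw [mem_fixedSpace_diag h, Submodule.mem_bot, funext_iff, Fin.forall_fin_two]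
          simp [mul_left_eq_self₀, ha1, hb1]
        rw [this, finrank_bot] at hW
        omega
    · rcases eq_or_ne ((a : ℂ) * b) 1 with hab | hab
      · refine ⟨Sum.inr ⟨a, (Polynomial.mem_nthRootsFinset hm _).mpr ?_⟩, ?_⟩
        · rw [← Units.val_pow_eq_pow_val, ha, Units.val_one]
        · ext v
          rw [mem_fixedSpace_antidiag h, mem_line]
          simp only [lineCoeff, Sum.elim_inr]
          constructor
          · intro hv
            exact ⟨by linear_combination -hv, by linear_combination (b : ℂ) * hv + v 1 * hab⟩
          · rintro ⟨h1, -⟩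
            linear_combination -h1
      · have : fixedSpace g = ⊥ := by
          ext v
          rw [mem_fixedSpace_antidiag h, Submodule.mem_bot, funext_iff, Fin.forall_fin_two]
          constructor
          · rintro ⟨h1, h2⟩
            have h0 : v 0 = 0 := by
              have : ((a : ℂ) * b - 1) * v 0 = 0 := by linear_combination h1 + (a : ℂ) * h2
              exact (mul_eq_zero.mp this).resolve_left (sub_ne_zero.mpr hab)
            exact ⟨h0, by rw [← h2, h0, mul_zero]; rfl⟩
          · rintro ⟨h1, h2⟩
            rw [h1, h2]; simp
        rw [this, finrank_bot] at hW
        omega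
  · rintro ⟨i, rfl⟩
    refine ⟨by rw [finrank_line (lineCoeff_ne_zero i)], ?_⟩
    obtain ⟨ω, hω, hωq, hωm⟩ := exists_root_ne_one (p := p) hq
    rcases i with i | ζ
    · fin_cases i
      · obtain ⟨g, hg, h, -⟩ := exists_mem_diag (m := p * q) (p := p) ω 1 hωm (by simp)
          (by simp [hdiv, hωq])
        refine ⟨g, hg, ?_⟩
        ext v
        rw [mem_fixedSpace_diag h, mem_line]
        simp [lineCoeff, mul_left_eq_self₀, hω]
      · obtain ⟨g, hg, h, -⟩ := exists_mem_diag (m := p * q) (p := p) 1 ω (by simp) hωm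
          (by simp [hdiv, hωq])
        refine ⟨g, hg, ?_⟩
        ext v
        rw [mem_fixedSpace_diag h, mem_line]
        simp [lineCoeff, mul_left_eq_self₀, hω]
    · obtain ⟨u, hu, hum⟩ := unit_of_mem_nthRootsFinset hm ζ
      obtain ⟨g, hg, h, -⟩ := exists_mem_antidiag (m := p * q) (p := p) u u⁻¹ hum
        (by rw [inv_pow, hum, inv_one]) (by simp)
      refine ⟨g, hg, ?_⟩
      ext v
      rw [mem_fixedSpace_antidiag h, mem_line]
      simp only [lineCoeff, Sum.elim_inr, ← hu]
      have huu : (u : ℂ) * (u⁻¹ : ℂˣ) = 1 := by simp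
      constructor
      · rintro ⟨h1, -⟩
        linear_combination -h1
      · intro hv
        exact ⟨by linear_combination -hv,
          by linear_combination ((u⁻¹ : ℂˣ) : ℂ) * hv + v 1 * huu⟩

omit hp in
theorem card_of_param {P : Matrix.GeneralLinearGroup (Fin 2) ℂ → Prop}
    (F : ℂ → Matrix (Fin 2) (Fin 2) ℂ) (hF : Function.Injective F)
    (h1 : ∀ a : ℂˣ, a ^ q = 1 → ∃ g, P g ∧ (g : Matrix (Fin 2) (Fin 2) ℂ) = F a)
    (h2 : ∀ g, P g → ∃ a : ℂˣ, a ^ q = 1 ∧ (g : Matrix (Fin 2) (Fin 2) ℂ) = F a) :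
    Nat.card {g // P g} = q := by
  choose! f hf hf' using h1
  have : NeZero q := ⟨by omega⟩
  have hmem : ∀ a : rootsOfUnity q ℂ, (a : ℂˣ) ^ q = 1 := fun a => (mem_rootsOfUnity _ _).mp a.2
  have e : rootsOfUnity q ℂ ≃ {g // P g} := Equiv.ofBijective
    (fun a => ⟨f a, hf _ (hmem a)⟩) ⟨fun a b hab => by
      have h := congrArg (fun g : {g // P g} => (g.1 : Matrix (Fin 2) (Fin 2) ℂ)) hab
      simp only [hf' _ (hmem _)] at h
      exact Subtype.ext (Units.ext (hF h)), fun ⟨g, hg⟩ => by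
      obtain ⟨a, ha, hga⟩ := h2 g hg
      exact ⟨⟨a, (mem_rootsOfUnity _ _).mpr ha⟩, Subtype.ext (Units.ext (by
        rw [hga]; exact hf' a ha))⟩⟩
  rw [← Nat.card_congr e, Complex.card_rootsOfUnity]

/-- Fixing a nonzero vector on the axis excludes antidiagonal matrices and forces one diagonal entry
to be 1; the determinant condition makes the other a q-th root of unity. -/
theorem fixerOrder_inl (i : Fin 2) :
    fixerOrder (Gmpn (p * q) p 2) (line (lineCoeff (Sum.inl i : LineIdx (p * q)))) = q := by
  have hdiv : p * q / p = q := Nat.mul_div_cancel_left _ hp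
  have hpow : ∀ a : ℂˣ, a ^ q = 1 → a ^ (p * q) = 1 := fun a ha => by
    rw [mul_comm, pow_mul, ha, one_pow]
  fin_cases i
  · refine card_of_param hq (fun a => !![a, 0; 0, 1]) (fun a b h => ?_) (fun a ha => ?_)
      (fun g ⟨hg, hW⟩ => ?_)
    · simpa using congrFun (congrFun h 0) 0
    · obtain ⟨g, hg, h, -⟩ := exists_mem_diag (m := p * q) (p := p) a 1 (hpow a ha) (by simp)
        (by simp [hdiv, ha])
      refine ⟨g, ⟨hg, fun v hv => ?_⟩, by simpa using h⟩
      rw [mem_line] at hv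
      rw [mem_fixedSpace_diag h]
      have : v 0 = 0 := by simpa [lineCoeff] using hv
      simp [this]
    · have hv := hW (show (![0, 1] : Fin 2 → ℂ) ∈ _ by rw [mem_line]; simp [lineCoeff])
      obtain ⟨a, b, ha, hb, hab, h | h⟩ := Gmpn_cases hg
      · rw [mem_fixedSpace_diag h] at hv
        have hb1 : (b : ℂ) = 1 := by simpa using hv.2
        have hb1' : b = 1 := Units.ext hb1
        rw [hdiv, hb1', mul_one] at hab
        exact ⟨a, hab, by rw [h, hb1]⟩
      · rw [mem_fixedSpace_antidiag h] at hv
        simp at hv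
  · refine card_of_param hq (fun a => !![1, 0; 0, a]) (fun a b h => ?_) (fun a ha => ?_)
      (fun g ⟨hg, hW⟩ => ?_)
    · simpa using congrFun (congrFun h 1) 1
    · obtain ⟨g, hg, h, -⟩ := exists_mem_diag (m := p * q) (p := p) 1 a (by simp) (hpow a ha)
        (by simp [hdiv, ha])
      refine ⟨g, ⟨hg, fun v hv => ?_⟩, by simpa using h⟩
      rw [mem_line] at hv
      rw [mem_fixedSpace_diag h]
      have : v 1 = 0 := by simpa [lineCoeff] using hv
      simp [this]
    · have hv := hW (show (![1, 0] : Fin 2 → ℂ) ∈ _ by rw [mem_line]; simp [lineCoeff])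
      obtain ⟨a, b, ha, hb, hab, h | h⟩ := Gmpn_cases hg
      · rw [mem_fixedSpace_diag h] at hv
        have ha1 : (a : ℂ) = 1 := by simpa using hv.1
        have ha1' : a = 1 := Units.ext ha1
        rw [hdiv, ha1', one_mul] at hab
        exact ⟨b, hab, by rw [h, ha1]⟩
      · rw [mem_fixedSpace_antidiag h] at hv
        simp at hv

/-- The vector (u, 1) spans the line. A diagonal matrix fixing it is the identity, and an
antidiagonal one must have entries u and u⁻¹. -/
theorem fixerOrder_inr (ζ : Polynomial.nthRootsFinset (p * q) (1 : ℂ)) :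
    fixerOrder (Gmpn (p * q) p 2) (line (lineCoeff (Sum.inr ζ : LineIdx (p * q)))) = 2 := by
  have hm : 0 < p * q := Nat.mul_pos hp (by omega)
  obtain ⟨u, hu, hum⟩ := unit_of_mem_nthRootsFinset hm ζ
  obtain ⟨g, hg, h, -⟩ := exists_mem_antidiag (m := p * q) (p := p) u u⁻¹ hum
    (by rw [inv_pow, hum, inv_one]) (by simp)
  have huu : (u : ℂ) * (u⁻¹ : ℂˣ) = 1 := by simp
  have hgW : line (lineCoeff (Sum.inr ζ : LineIdx (p * q))) ≤ fixedSpace g := fun v hv => by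
    rw [mem_line] at hv
    simp only [lineCoeff, Sum.elim_inr, ← hu] at hv
    rw [mem_fixedSpace_antidiag h]
    exact ⟨by linear_combination -hv, by linear_combination ((u⁻¹ : ℂˣ) : ℂ) * hv + v 1 * huu⟩
  rw [fixerOrder, Nat.card_eq_two_iff]
  refine ⟨⟨1, one_mem _, fun v _ => by rw [mem_fixedSpace]; simp⟩, ⟨g, hg, hgW⟩, fun h1 => ?_, ?_⟩
  · have h2 := congrArg (fun g : Matrix.GeneralLinearGroup (Fin 2) ℂ =>
      (g : Matrix (Fin 2) (Fin 2) ℂ) 0 0) (congrArg Subtype.val h1)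
    simp [h] at h2
  · rw [Set.eq_univ_iff_forall]
    rintro ⟨g', hg', hW⟩
    have hv := hW (show (![(u : ℂ), 1] : Fin 2 → ℂ) ∈ _ by
      rw [mem_line]; simp [lineCoeff, hu])
    obtain ⟨a, b, -, -, -, h' | h'⟩ := Gmpn_cases hg'
    · rw [mem_fixedSpace_diag h'] at hv
      have ha : (a : ℂ) = 1 := by simpa [mul_left_eq_self₀] using hv.1
      have hb : (b : ℂ) = 1 := by simpa using hv.2
      left
      refine Subtype.ext (Units.ext ?_)
      change (g' : Matrix (Fin 2) (Fin 2) ℂ) = 1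
      rw [h', ha, hb, Matrix.one_fin_two]
    · rw [mem_fixedSpace_antidiag h'] at hv
      have ha : (a : ℂ) = u := by simpa using hv.1
      have hb : (b : ℂ) = (u⁻¹ : ℂˣ) := by
        have : (b : ℂ) * u = 1 := by simpa using hv.2
        linear_combination ((u⁻¹ : ℂˣ) : ℂ) * this - (b : ℂ) * huu
      right
      exact Subtype.ext (Units.ext (by rw [h', h, ha, hb]))

omit hp hq in
-- The factorization of x^m - y^m runs over the m-th roots of unity of the polynomial ring itself;
-- being powers of a constant primitive root, these are all constants.
theorem prod_linForm_inr {m : ℕ} (hm : 0 < m) :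
    ∏ ζ : Polynomial.nthRootsFinset m (1 : ℂ), linForm (lineCoeff (Sum.inr ζ : LineIdx m))
      = X 0 ^ m - X 1 ^ m := by
  obtain ⟨ζ₀, hζ⟩ := exists_unit_primitiveRoot hm.ne'
  have hζ' := hζ.map_of_injective (C_injective (Fin 2) ℂ)
  rw [hζ'.pow_sub_pow_eq_prod_sub_mul _ _ hm]
  have : ∀ ζ : Polynomial.nthRootsFinset m (1 : ℂ),
      linForm (lineCoeff (Sum.inr ζ : LineIdx m)) = X 0 - C (ζ : ℂ) * X 1 := fun ζ => by
    simp [linForm, lineCoeff, sub_eq_add_neg]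
  simp only [this]
  rw [Finset.prod_coe_sort (Polynomial.nthRootsFinset m (1 : ℂ))
    (fun ζ => (X 0 - C ζ * X 1 : MvPolynomial (Fin 2) ℂ))]
  refine Finset.prod_bij (fun ζ _ => C ζ) (fun ζ hζ => ?_) (fun a _ b _ h => C_injective _ _ h)
    (fun ξ hξ => ?_) (fun _ _ => rfl)
  · rw [Polynomial.mem_nthRootsFinset hm] at hζ ⊢
    rw [← C_pow, hζ, C_1]
  · rw [Polynomial.mem_nthRootsFinset hm] at hξ
    have : NeZero m := ⟨hm.ne'⟩
    obtain ⟨i, -, rfl⟩ := hζ'.eq_pow_of_pow_eq_one hξ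
    refine ⟨_, ?_, C_pow _ _⟩
    rw [Polynomial.mem_nthRootsFinset hm, ← pow_mul, mul_comm, pow_mul, hζ.pow_eq_one, one_pow]

/-- The form must depend on the line alone, so `Function.invFun` recovers the index, uniquely by
`line_injective`. The stabilizer orders q and 2 give (xy)^q (x^m - y^m)², which is Δ because (x^m -
y^m)² = σ₂² - 4σ₁^p. -/
theorem exists_defining_forms :
    ∃ α : Submodule ℂ (Fin 2 → ℂ) → MvPolynomial (Fin 2) ℂ,
      (∀ W ∈ hyperplanes (Gmpn (p * q) p 2), IsDefiningForm W (α W)) ∧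
      (hyperplanes (Gmpn (p * q) p 2)).Finite ∧
      z (p * q) = ∏ᶠ W ∈ hyperplanes (Gmpn (p * q) p 2), α W ∧
      (Delta (p * q) p : MvPolynomial (Fin 2) ℂ) =
        ∏ᶠ W ∈ hyperplanes (Gmpn (p * q) p 2), α W ^ fixerOrder (Gmpn (p * q) p 2) W := by
  have hm : 0 < p * q := Nat.mul_pos hp (by omega)
  have hinj := line_injective hm
  have hα : ∀ i : LineIdx (p * q), linForm (lineCoeff
      (Function.invFun (fun i : LineIdx (p * q) => line (lineCoeff i)) (line (lineCoeff i)))) =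
      linForm (lineCoeff i) := fun i => by
    rw [Function.leftInverse_invFun hinj i]
  have h0 : linForm (lineCoeff (Sum.inl 0 : LineIdx (p * q))) = X 0 := by simp [linForm, lineCoeff]
  have h1 : linForm (lineCoeff (Sum.inl 1 : LineIdx (p * q))) = X 1 := by simp [linForm, lineCoeff]
  refine ⟨fun W => linForm (lineCoeff
    (Function.invFun (fun i : LineIdx (p * q) => line (lineCoeff i)) W)), ?_, ?_, ?_, ?_⟩
  · rw [hyperplanes_eq hp hq]
    rintro _ ⟨i, rfl⟩
    simp only [hα]
    exact isDefiningForm_linForm _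
  · rw [hyperplanes_eq hp hq]
    exact Set.finite_range _
  · rw [hyperplanes_eq hp hq, finprod_mem_range hinj]
    simp only [hα]
    rw [finprod_eq_prod_of_fintype, Fintype.prod_sum_type, Fin.prod_univ_two,
      prod_linForm_inr hm, h0, h1, z]
  · rw [hyperplanes_eq hp hq, finprod_mem_range hinj]
    simp only [hα]
    rw [finprod_eq_prod_of_fintype, Fintype.prod_sum_type, Fin.prod_univ_two,
      fixerOrder_inl hp hq, fixerOrder_inl hp hq, h0, h1]
    simp only [fixerOrder_inr hp hq]
    rw [Finset.prod_pow, prod_linForm_inr hm]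
    have h4 : ((4 : R (p * q) p) : MvPolynomial (Fin 2) ℂ) = 4 := rfl
    have h2 : (sigma2 (p * q) p : MvPolynomial (Fin 2) ℂ) = X 0 ^ (p * q) + X 1 ^ (p * q) := rfl
    simp only [Delta, disc, MulMemClass.coe_mul, AddSubgroupClass.coe_sub, SubmonoidClass.coe_pow,
      h4, h2, coe_sigma1 hp]
    ring

end Hyperplanes

/-- `S/(z)` is the direct sum of the cokernels of the blocks of multiplication by `z`. -/
def sModZEquivBlocks {p n : ℕ} (hp : 0 < p) (hm : 0 < p * (n + 1)) (hpm : p ∣ p * (n + 1)) :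
    SModZ hm hpm ≃ₗ[R (p * (n + 1)) p] ((i : Idx p (n + 1)) →
      Cok (zBlock p n i.1 i.2.1 i.2.2)) :=
  cokEquivBlocks (comb p (n + 1)) (comb_injective hp n.succ_pos) (comb_surjective hp n.succ_pos)
    (mkZ hm hpm) Ideal.Quotient.mk_surjective (fun f => z (p * (n + 1)) * f)
    (fun f => by
      change Ideal.Quotient.mk (Ideal.span {z (p * (n + 1))}) f = 0 ↔ _
      rw [Ideal.Quotient.eq_zero_iff_mem, Ideal.mem_span_singleton]; rfl)
    (idxShift p n) (fun i => zBlock p n i.1 i.2.1 i.2.2) (z_mul_comb hp)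

end ReflGroup

end

open ReflGroup in
theorem mainTheorem7 (m p q : ℕ) (hm : 0 < m) (hpm : p ∣ m) (hne : m ≠ p) (hp : Even p)
    (hq : q = m / p) :
    -- `σ₁`, `σ₂` are basic invariants: `R = ℂ[σ₁, σ₂]` is a polynomial ring
    (AlgebraicIndependent ℂ ![sigma1 m p, sigma2 m p] ∧
      Algebra.adjoin ℂ {sigma1 m p, sigma2 m p} = (⊤ : Subalgebra ℂ (R m p))) ∧
    -- `z = ∏ α_W` and `Δ = ∏ α_W ^ e_W` over the reflecting hyperplanes `W` of `G(m,p,2)`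
    (∃ α : Submodule ℂ (Fin 2 → ℂ) → MvPolynomial (Fin 2) ℂ,
      (∀ W ∈ hyperplanes (Gmpn m p 2), IsDefiningForm W (α W)) ∧
      (hyperplanes (Gmpn m p 2)).Finite ∧
      z m = ∏ᶠ W ∈ hyperplanes (Gmpn m p 2), α W ∧
      (Delta m p : MvPolynomial (Fin 2) ℂ) =
        ∏ᶠ W ∈ hyperplanes (Gmpn m p 2), α W ^ fixerOrder (Gmpn m p 2) W) ∧
    -- the two forms of the decomposition of `S/(z)` over `R/(Δ)`
    Nonempty (SModZ hm hpm ≃ₗ[RDelta m p]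
      ((j : Finset.Icc 1 p) → Fin (2 * (q - 1)) →
        XMod (sigma1 m p) (sigma2 m p) (p := p) j (le_of_mem_Icc j)) ×
      ((j : Finset.Icc 1 ((p - 2) / 2)) → Fin 2 →
        NMod (sigma1 m p) (sigma2 m p) (p := p) j (le_of_mem_Icc_half j)) ×
      ((j : Finset.Icc 1 ((p - 2) / 2)) → Fin (2 * (q - 1) ^ 2) →
        KMod (sigma1 m p) (sigma2 m p) (p := p) j (le_of_mem_Icc_half j)) ×
      (Fin (2 * (q - 1).choose 2) →
        KMod (sigma1 m p) (sigma2 m p) (p := p) (p / 2) (Nat.div_le_self p 2)) ×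
      (Fin (2 * (q - 1).choose 2) →
        KMod (sigma1 m p) (sigma2 m p) (p := p) 0 (Nat.zero_le p)) ×
      AMod (sigma1 m p) (sigma2 m p) p ×
      (Fin (q - 1) → BMod (sigma1 m p) (sigma2 m p) p) ×
      CPlus (sigma1 m p) (sigma2 m p) hp ×
      (Fin (q - 1) → DPlus (sigma1 m p) (sigma2 m p) hp) ×
      CMinus (sigma1 m p) (sigma2 m p) hp ×
      (Fin (q - 1) → DMinus (sigma1 m p) (sigma2 m p) hp) ×
      RDelta m p) ∧
    Nonempty (SModZ hm hpm ≃ₗ[RDelta m p]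
      ((j : Finset.Icc 1 p) → Fin (2 * (q - 1)) →
        XMod (sigma1 m p) (sigma2 m p) (p := p) j (le_of_mem_Icc j)) ×
      ((j : Finset.Icc 1 ((p - 2) / 2)) → Fin 2 →
        NMod (sigma1 m p) (sigma2 m p) (p := p) j (le_of_mem_Icc_half j)) ×
      ((j : Finset.Icc 1 ((p - 2) / 2)) → Fin (2 * (q - 1) ^ 2) →
        KMod (sigma1 m p) (sigma2 m p) (p := p) j (le_of_mem_Icc_half j)) ×
      AMod (sigma1 m p) (sigma2 m p) p ×
      (Fin (q - 1 + 2 * (q - 1).choose 2) → BMod (sigma1 m p) (sigma2 m p) p) ×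
      CPlus (sigma1 m p) (sigma2 m p) hp ×
      (Fin (q - 1 + 2 * (q - 1).choose 2) → DPlus (sigma1 m p) (sigma2 m p) hp) ×
      CMinus (sigma1 m p) (sigma2 m p) hp ×
      (Fin (q - 1 + 2 * (q - 1).choose 2) → DMinus (sigma1 m p) (sigma2 m p) hp) ×
      RDelta m p) := by
  obtain ⟨q', rfl⟩ := hpm
  have hp0 : 0 < p := Nat.pos_of_mul_pos_right hm
  rw [Nat.mul_div_cancel_left _ hp0] at hq
  subst hq
  have hq0 : 0 < q := Nat.pos_of_mul_pos_left hm
  have hq1 : 1 < q := by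
    rcases Nat.lt_or_ge 1 q with h | h
    · exact h
    · obtain rfl : q = 1 := by omega
      exact absurd (mul_one p) hne
  obtain ⟨n, rfl⟩ : ∃ n, q = n + 1 := ⟨q - 1, by omega⟩
  have hc : (2 : R (p * (n + 1)) p) * algebraMap ℂ _ (1 / 2) = 1 := by
    rw [← map_ofNat (algebraMap ℂ (R (p * (n + 1)) p)) 2, ← map_mul]
    norm_num
  refine ⟨⟨algebraicIndependent_sigma hp0 hq0, adjoin_sigma hp0 hq0⟩,
    exists_defining_forms hp0 hq1, ?_, ?_⟩
  · have h := decomposition_one (sigma1 (p * (n + 1)) p) (sigma2 (p * (n + 1)) p) hc hp hp0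
      (fun _ _ => rfl) (sModZEquivBlocks hp0 hm (Dvd.intro _ rfl))
    rw [Nat.add_sub_cancel]
    exact h
  · have h := decomposition_two (sigma1 (p * (n + 1)) p) (sigma2 (p * (n + 1)) p) hc hp hp0
      (fun _ _ => rfl) (sModZEquivBlocks hp0 hm (Dvd.intro _ rfl))
    rw [Nat.add_sub_cancel]
    exact h
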